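/- **Setting.** Let $\Gamma$ be a connected simplicial graph with vertex set $V$; its edges are two-element subsets of $V$ and $d_\Gamma$ is the path metric. Assume that $\Gamma$ is fine (for each $n$, every edge lies in only finitely many circuits, i.e. embedded loops, of length $n$) and hyperbolic. Let $G$ be a countable group acting on $\Gamma$ by graph automorphisms with finitely many orbits of vertices and edges and with finite edge stabilizers. Assume that no two vertices of infinite valency are adjacent. Let $\partial\Gamma$ be the Gromov boundary of $\Gamma$. Geodesics may be finite (possibly constant), rays, or bi-infinite; they have endpoints in $V\cup\partial\Gamma$. Let $\delta\ge 1$ be an integer such that in every geodesic triangle of $\Gamma$, with corners in $V\cup\partial\Gamma$, each side is contained in the $\delta$-neighborhood of the union of the other two. An *angle* is an unordered pair $(e,e')$ of edges with a common vertex; it is *trivial* if $e=e'$. A *size for angles* is a $G$-invariant set $\Theta$ of angles that contains all trivial angles and consists of finitely many $G$-orbits. For sets of angles $\Theta,\Theta'$, the sum $\Theta+\Theta'$ is the set of all angles $(e,e'')$ for which there is an edge $e'$ with $(e,e')\in\Theta$ and $(e',e'')\in\Theta'$, and $n\Theta$ is the $n$-fold sum of $\Theta$ with itself. Let $\Theta^{(3)}$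 be the set of all angles $(e,e')$ for which there is a geodesic triangle (possibly with some corners in $\partial\Gamma$) with sides $c,c',c''$ such that $c$ and $c'$ start at a common corner $v\in V$ with initial edges $e$ and $e'$, and such that $c''$ does not meet $v$. A geodesic is *$\Theta$-small* if at each of its internal vertices the angle formed by its two edges there belongs to $\Theta$. For a size for angles $\Theta$ and a real number $d>0$, the *relative Rips complex* $P_{d,\Theta}$ is the simplicial complex with vertex set $V$ in which a non-empty finite set $\sigma\subseteq V$ spans a simplex if and only if between any two vertices $v,v'\in\sigma$ there is a $\Theta$-small geodesic of length at most $d$. Simplicial complexes are identified with their geometric realizations, with the weak topology. **Proposition.** Let $\Theta$ be a size for angles and $d$ a real number such that $d\ge 4\delta$ and $7\Theta^{(3)}\subseteq\Theta$. Then $P_{d,\Theta}$ is contractible. Moreover, let $K$ be a non-empty finite subcomplex of $P_{d,\Theta}$, and let $L$ be the subcomplex of $P_{d,\Theta}$ spanned by all vertices $\tilde v$ for which there are vertices $v,v'$ of $K$ such that $\tilde v$ belongs to a geodesic between $v$ and $v'$. Then $K\subseteq L$, and $K$ is contractible within $L$, i.e. the inclusion $K\to L$ is homotopic to a constant map. 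-/

import Mathlib

namespace RelRips

/-! ### Geometric realization of simplicial complexes (weak topology) -/

section Realization

variable {V : Type*}

/-- The closed simplex spanned by a finite set `s` of vertices, in barycentric coordinates.
As a subspace of `V → ℝ` it carries its usual Euclidean topology, because all coordinates
outside the finite set `s` vanish. -/
def closedSimplex (s : Finset V) : Set (V → ℝ) :=
  {x | (∀ v, 0 ≤ x v) ∧ (∀ v, v ∉ s → x v = 0) ∧ ∑ v ∈ s, x v = 1}

/-- The points of the geometric realization of `K`, in barycentric coordinates. -/
def Realization (K : PreAbstractSimplicialComplex V) : Type _ :=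
  {x : V → ℝ // ∃ s ∈ K.faces, x ∈ closedSimplex s}

/-- The inclusion of a closed simplex into the realization. -/
def Realization.ofSimplex (K : PreAbstractSimplicialComplex V) (s : K.faces)
    (x : closedSimplex s.1) : Realization K :=
  ⟨x.1, s.1, s.2, x.2⟩

/-- The weak topology: a set is open if and only if its intersection with every closed simplex
is open in this simplex. -/
instance (K : PreAbstractSimplicialComplex V) : TopologicalSpace (Realization K) :=
  ⨆ s : K.faces, TopologicalSpace.coinduced (Realization.ofSimplex K s) inferInstance

theorem Realization.isOpen_iff (K : PreAbstractSimplicialComplex V) (U : Set (Realization K)) :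
    IsOpen U ↔ ∀ s : K.faces, IsOpen (Realization.ofSimplex K s ⁻¹' U) :=
  isOpen_iSup_iff

/-- The inclusion of the realization of a subcomplex. -/
def Realization.inclusion {K L : PreAbstractSimplicialComplex V} (h : K ≤ L) :
    C(Realization K, Realization L) where
  toFun x := ⟨x.1, by
    obtain ⟨s, hs, hx⟩ := x.2
    exact ⟨s, h hs, hx⟩⟩
  continuous_toFun := by
    refine ⟨fun U hU => ?_⟩
    rw [Realization.isOpen_iff] at hU ⊢
    intro s
    exact hU ⟨s.1, h s.2⟩

/-- The subcomplex of `P` spanned by a set `S` of vertices: all simplices of `P` all of whose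
vertices belong to `S`. -/
def spanned (P : PreAbstractSimplicialComplex V) (S : Set V) : PreAbstractSimplicialComplex V where
  faces := {s | s ∈ P.faces ∧ ∀ v ∈ s, v ∈ S}
  isRelLowerSet_faces := by
    intro s hs
    have hP := P.isRelLowerSet_faces hs.1
    exact ⟨hP.1, fun t hts ht => ⟨hP.2 hts ht, fun v hv => hs.2 v (hts hv)⟩⟩

end Realization

/-! ### Geodesics in graphs, the Gromov boundary, hyperbolicity and fineness -/

section Graph

variable {V : Type*} (Γ : SimpleGraph V)

/-- Geodesic rays. -/
def Ray : Type _ :=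
  {r : ℕ → V // ∀ i j : ℕ, (Γ.dist (r i) (r j) : ℤ) = |(i : ℤ) - j|}

/-- Two geodesic rays are asymptotic if they stay at bounded distance. -/
def asymptotic : Setoid (Ray Γ) where
  r a b := ∃ C : ℕ, ∀ n, Γ.edist (a.1 n) (b.1 n) ≤ C
  iseqv :=
    { refl := fun a => ⟨0, fun n => by simp⟩
      symm := fun ⟨C, h⟩ => ⟨C, fun n => by rw [SimpleGraph.edist_comm]; exact h n⟩
      trans := fun ⟨C, h⟩ ⟨D, k⟩ => ⟨C + D, fun n => by
        push_cast
        exact SimpleGraph.edist_triangle.trans (add_le_add (h n) (k n))⟩ }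

/-- The Gromov boundary of `Γ`. -/
def Boundary : Type _ := Quotient (asymptotic Γ)

/-- Vertices together with boundary points of `Γ`. -/
abbrev Endpoint : Type _ := V ⊕ Boundary Γ

/-- Geodesics (finite, rays and bi-infinite), parametrized by an interval `dom` of integers.
Values of `toFun` outside `dom` are irrelevant. -/
structure Geodesic where
  dom : Set ℤ
  toFun : ℤ → V
  nonempty : dom.Nonempty
  ordConnected : dom.OrdConnected
  dist_eq : ∀ i ∈ dom, ∀ j ∈ dom, (Γ.dist (toFun i) (toFun j) : ℤ) = |i - j|

variable {Γ}

namespace Geodesic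

/-- The set of vertices on a geodesic. -/
def support (c : Geodesic Γ) : Set V := c.toFun '' c.dom

/-- `c` ends in the vertex or boundary point `ξ`. -/
def HasTarget (c : Geodesic Γ) : Endpoint Γ → Prop
  | Sum.inl v => ∃ i, IsGreatest c.dom i ∧ c.toFun i = v
  | Sum.inr ξ => ∃ r : Ray Γ, Quotient.mk (asymptotic Γ) r = ξ ∧
      ∃ i : ℤ, ∀ n : ℕ, i + n ∈ c.dom ∧ c.toFun (i + n) = r.1 n

/-- `c` starts in the vertex or boundary point `ξ`. -/
def HasSource (c : Geodesic Γ) : Endpoint Γ → Prop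
  | Sum.inl v => ∃ i, IsLeast c.dom i ∧ c.toFun i = v
  | Sum.inr ξ => ∃ r : Ray Γ, Quotient.mk (asymptotic Γ) r = ξ ∧
      ∃ i : ℤ, ∀ n : ℕ, i - n ∈ c.dom ∧ c.toFun (i - n) = r.1 n

/-- `c` is a geodesic between `ξ` and `ξ'`, in one of the two directions. -/
def Joins (c : Geodesic Γ) (ξ ξ' : Endpoint Γ) : Prop :=
  (c.HasSource ξ ∧ c.HasTarget ξ') ∨ (c.HasSource ξ' ∧ c.HasTarget ξ)

/-- `e` is the initial edge of the geodesic `c` that starts in the vertex `v`. -/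
def HasInitialEdge (c : Geodesic Γ) (v : V) (e : Sym2 V) : Prop :=
  ∃ i, IsLeast c.dom i ∧ c.toFun i = v ∧ i + 1 ∈ c.dom ∧ e = s(v, c.toFun (i + 1))

/-- All angles of `c` at its internal vertices belong to `Θ`. -/
def IsSmall (c : Geodesic Γ) (Θ : Set (Sym2 (Sym2 V))) : Prop :=
  ∀ i, i - 1 ∈ c.dom → i + 1 ∈ c.dom →
    s(s(c.toFun (i - 1), c.toFun i), s(c.toFun i, c.toFun (i + 1))) ∈ Θ

end Geodesic

variable (Γ)

/-- In all geodesic triangles with corners in `V ∪ ∂Γ`, each side is contained in the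
(closed) `δ`-neighborhood of the union of the other two. -/
def IsHyperbolicityConstant (δ : ℕ) : Prop :=
  ∀ (ξ₁ ξ₂ ξ₃ : Endpoint Γ) (c c' c'' : Geodesic Γ),
    c.Joins ξ₁ ξ₂ → c'.Joins ξ₂ ξ₃ → c''.Joins ξ₁ ξ₃ →
      ∀ x ∈ c.support, ∃ y ∈ c'.support ∪ c''.support, Γ.dist x y ≤ δ

/-- `Γ` is fine: for each `n`, every edge is contained in only finitely many circuits of
length `n`. Circuits are recorded by their sets of edges. -/
def IsFine : Prop :=
  ∀ (n : ℕ), ∀ e ∈ Γ.edgeSet,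
    {E : Set (Sym2 V) | ∃ (u : V) (p : Γ.Walk u u),
      p.IsCycle ∧ p.length = n ∧ e ∈ p.edges ∧ E = {f | f ∈ p.edges}}.Finite

/-! ### Angles -/

/-- The angles of `Γ`: unordered pairs of edges with a common vertex. -/
def angles : Set (Sym2 (Sym2 V)) :=
  {θ | ∃ e ∈ Γ.edgeSet, ∃ e' ∈ Γ.edgeSet, (∃ v, v ∈ e ∧ v ∈ e') ∧ θ = s(e, e')}

/-- The trivial angles of `Γ`. -/
def trivialAngles : Set (Sym2 (Sym2 V)) :=
  {θ | ∃ e ∈ Γ.edgeSet, θ = s(e, e)}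

/-- The sum of two sets of angles. -/
def angleSum (A B : Set (Sym2 (Sym2 V))) : Set (Sym2 (Sym2 V)) :=
  {θ | θ ∈ angles Γ ∧ ∃ e e'' : Sym2 V, θ = s(e, e'') ∧
    ∃ e' ∈ Γ.edgeSet, s(e, e') ∈ A ∧ s(e', e'') ∈ B}

/-- The `n`-fold sum of a set of angles; the empty sum is the set of trivial angles. -/
def angleMultiple (A : Set (Sym2 (Sym2 V))) : ℕ → Set (Sym2 (Sym2 V))
  | 0 => trivialAngles Γ
  | n + 1 => angleSum Γ (angleMultiple A n) A

/-- The set `Θ⁽³⁾` of all angles `(e, e')` at a corner `v ∈ V` of a geodesic triangle (possibly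
with some corners in `∂Γ`) whose side opposite to `v` does not meet `v`. -/
def thetaThree : Set (Sym2 (Sym2 V)) :=
  {θ | ∃ (v : V) (ξ ξ' : Endpoint Γ) (c c' c'' : Geodesic Γ) (e e' : Sym2 V),
    c.HasSource (Sum.inl v) ∧ c.HasTarget ξ ∧ c'.HasSource (Sum.inl v) ∧ c'.HasTarget ξ' ∧
    c''.Joins ξ ξ' ∧ v ∉ c''.support ∧
    c.HasInitialEdge v e ∧ c'.HasInitialEdge v e' ∧ θ = s(e, e')}

end Graph

section Action

variable (G : Type*) [Group G] {V : Type*} [MulAction G V] (Γ : SimpleGraph V)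

/-- The standing assumptions on the action: `G` acts on `Γ` by graph automorphisms, with finitely
many orbits of vertices and of edges, and the isotropy group of each edge is finite. -/
structure IsCocompactEdgeFiniteAction : Prop where
  adj_smul : ∀ (g : G) (u v : V), Γ.Adj u v → Γ.Adj (g • u) (g • v)
  cofinite_vertices : ∃ F : Set V, F.Finite ∧ ∀ v, ∃ u ∈ F, ∃ g : G, v = g • u
  cofinite_edges : ∃ F : Set (Sym2 V), F.Finite ∧ F ⊆ Γ.edgeSet ∧
    ∀ e ∈ Γ.edgeSet, ∃ f ∈ F, ∃ g : G, e = f.map (g • ·)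
  finite_isotropy : ∀ e ∈ Γ.edgeSet, {g : G | e.map (g • ·) = e}.Finite

/-- `Θ` is a size for angles: a `G`-invariant, `G`-cofinite set of angles that contains all
trivial angles. -/
structure IsSizeForAngles (Θ : Set (Sym2 (Sym2 V))) : Prop where
  subset_angles : Θ ⊆ angles Γ
  trivial_subset : trivialAngles Γ ⊆ Θ
  invariant : ∀ (g : G), ∀ θ ∈ Θ, θ.map (Sym2.map (g • ·)) ∈ Θ
  cofinite : ∃ F : Set (Sym2 (Sym2 V)), F.Finite ∧ F ⊆ Θ ∧
    ∀ θ ∈ Θ, ∃ φ ∈ F, ∃ g : G, θ = φ.map (Sym2.map (g • ·))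

end Action

/-! ### The relative Rips complex -/

section Rips

variable {V : Type*} (Γ : SimpleGraph V)

/-- There is a `(d, Θ)`-small geodesic between the vertices `v` and `v'`, that is, a `Θ`-small
geodesic of length at most `d` (the length of a geodesic is the distance of its endpoints). -/
def SmallJoined (d : ℝ) (Θ : Set (Sym2 (Sym2 V))) (v v' : V) : Prop :=
  (Γ.dist v v' : ℝ) ≤ d ∧
    ∃ c : Geodesic Γ, c.Joins (Sum.inl v) (Sum.inl v') ∧ c.IsSmall Θ

/-- The relative Rips complex `P_{d,Θ}`. -/
def relativeRips (d : ℝ) (Θ : Set (Sym2 (Sym2 V))) : PreAbstractSimplicialComplex V where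
  faces := {s | s.Nonempty ∧ ∀ v ∈ s, ∀ v' ∈ s, SmallJoined Γ d Θ v v'}
  isRelLowerSet_faces := by
    intro s hs
    exact ⟨hs.1, fun t hts ht => ⟨ht, fun v hv v' hv' => hs.2 v (hts hv) v' (hts hv')⟩⟩

/-- The vertices on geodesics between vertices of `K`. -/
def geodesicHull (K : PreAbstractSimplicialComplex V) : Set V :=
  {w | ∃ v v' : V, {v} ∈ K.faces ∧ {v'} ∈ K.faces ∧
    ∃ c : Geodesic Γ, c.Joins (Sum.inl v) (Sum.inl v') ∧ w ∈ c.support}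

end Rips

end RelRips

namespace RelRips

/-! ### Finite geodesics -/

section FiniteGeodesics

variable {V : Type*} {Γ : SimpleGraph V}

/-! Fix a base vertex x₀. The geometric core is `exists_move`: in a finite vertex set S containing
some vertex other than x₀, one vertex can be replaced by a vertex nearer to x₀ on a geodesic to x₀,
keeping all its Rips neighbours in S. Since simplices are determined by their pairs of vertices,
this replacement is contiguous to the identity. Iterating it lowers the sum of the distances to x₀
and so deforms any map into a finite subcomplex to the constant x₀ (`exists_homotopicWith_const`).

The choice of the move rests on a dichotomy (`threeAngle_of_not_between`): the directions at w
towards a and b differ by an angle of Θ⁽³⁾, unless w lies between a and b. Let v ∈ S be farthest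
from x₀, and call an angle on a geodesic from S to x₀ large if it is outside 2Θ⁽³⁾. If large angles
occur at vertices w with d(w,x₀) ≥ d(v,x₀) − d, take such a w farthest from x₀ and move to it a
vertex of S seeing this angle (`smallJoined_of_largeAt`). Otherwise move v: to x₀ itself if d(v,x₀)
≤ d, else by 2δ towards x₀. In the last case thin triangles bound the new distances, and comparing
directions towards v, x₀ and u keeps the new angles in 4Θ⁽³⁾, so 7Θ⁽³⁾ ⊆ Θ is more than enough.

For a finite K, choose x₀ in K; all moves stay on geodesics from vertices of K to x₀, hence in L.
For the whole complex, the contraction is built skeleton by skeleton. The prism over a simplex is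
the cone over its boundary, so a null-homotopy of the boundary map is an extension over the prism
(`exists_extension`). -/

theorem dist_getVert_le {a b : V} (p : Γ.Walk a b) {i j : ℕ} (hij : i ≤ j) :
    Γ.dist (p.getVert i) (p.getVert j) ≤ j - i := by
  have h := (Γ.dist_le ((p.drop i).take (j - i))).trans 
    ((SimpleGraph.Walk.take_length _ _).trans_le (min_le_left _ _))
  rwa [SimpleGraph.Walk.drop_getVert, Nat.add_sub_cancel' hij] at h

/-- The geodesic parametrized by a walk of minimal length. -/
def Geodesic.ofWalk (hconn : Γ.Connected) {a b : V} (p : Γ.Walk a b)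
    (hp : p.length = Γ.dist a b) : Geodesic Γ where
  dom := Set.Icc 0 (p.length : ℤ)
  toFun i := p.getVert i.toNat
  nonempty := ⟨0, by simp⟩
  ordConnected := Set.ordConnected_Icc
  dist_eq := by
    -- The three pieces have lengths at most m, n − m and length − n, and must add up to the full
    -- distance, so every bound is an equality.
    have key : ∀ m n : ℕ, m ≤ n → n ≤ p.length →
        Γ.dist (p.getVert m) (p.getVert n) = n - m := by
      intro m n hmn hn
      have h1 := dist_getVert_le p (Nat.zero_le m)
      have h2 := dist_getVert_le p hmn
      have h3 := dist_getVert_le p hn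
      rw [p.getVert_zero] at h1
      rw [p.getVert_length] at h3
      have h4 := hconn.dist_triangle (u := a) (v := p.getVert m) (w := b)
      have h5 := hconn.dist_triangle (u := p.getVert m) (v := p.getVert n) (w := b)
      omega
    rintro i ⟨hi0, hi⟩ j ⟨hj0, hj⟩
    lift i to ℕ using hi0
    lift j to ℕ using hj0
    simp only [Int.toNat_natCast]
    rcases le_total i j with h | h
    · rw [key i j h (by omega), abs_sub_comm, abs_of_nonneg (by omega)]; omega
    · rw [SimpleGraph.dist_comm, key j i h (by omega), abs_of_nonneg (by omega)]; omega

theorem Geodesic.ofWalk_hasSource (hconn : Γ.Connected) {a b : V} (p : Γ.Walk a b)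
    (hp : p.length = Γ.dist a b) : (Geodesic.ofWalk hconn p hp).HasSource (Sum.inl a) :=
  ⟨0, isLeast_Icc (by positivity), by simp [Geodesic.ofWalk]⟩

theorem Geodesic.ofWalk_hasTarget (hconn : Γ.Connected) {a b : V} (p : Γ.Walk a b)
    (hp : p.length = Γ.dist a b) : (Geodesic.ofWalk hconn p hp).HasTarget (Sum.inl b) :=
  ⟨p.length, isGreatest_Icc (by positivity), by simp [Geodesic.ofWalk]⟩

theorem exists_geodesic (hconn : Γ.Connected) (a b : V) :
    ∃ c : Geodesic Γ, c.HasSource (Sum.inl a) ∧ c.HasTarget (Sum.inl b) := by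
  obtain ⟨p, hp⟩ := hconn.exists_walk_length_eq_dist a b
  exact ⟨_, Geodesic.ofWalk_hasSource hconn p hp, Geodesic.ofWalk_hasTarget hconn p hp⟩

theorem Geodesic.dom_eq_Icc {c : Geodesic Γ} {i j : ℤ} (hi : IsLeast c.dom i)
    (hj : IsGreatest c.dom j) : c.dom = Set.Icc i j :=
  Set.Subset.antisymm (fun _ hk => ⟨hi.2 hk, hj.2 hk⟩) (c.ordConnected.out hi.1 hj.1)

theorem Geodesic.Joins.exists_uIcc {c : Geodesic Γ} {a b : V}
    (h : c.Joins (Sum.inl a) (Sum.inl b)) :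
    ∃ i j : ℤ, c.dom = Set.uIcc i j ∧ c.toFun i = a ∧ c.toFun j = b := by
  rcases h with ⟨⟨i, hi, hia⟩, j, hj, hjb⟩ | ⟨⟨j, hj, hjb⟩, i, hi, hia⟩
  · exact ⟨i, j, by rw [Geodesic.dom_eq_Icc hi hj, Set.uIcc_of_le (hi.2 hj.1)], hia, hjb⟩
  · exact ⟨i, j, by rw [Geodesic.dom_eq_Icc hj hi, Set.uIcc_of_ge (hj.2 hi.1)], hia, hjb⟩

theorem Geodesic.joins_of_dom_eq {c : Geodesic Γ} {i j : ℤ} (h : c.dom = Set.uIcc i j) :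
    c.Joins (Sum.inl (c.toFun i)) (Sum.inl (c.toFun j)) := by
  rcases le_total i j with hij | hij
  · rw [Set.uIcc_of_le hij] at h
    exact Or.inl ⟨⟨i, h ▸ isLeast_Icc hij, rfl⟩, ⟨j, h ▸ isGreatest_Icc hij, rfl⟩⟩
  · rw [Set.uIcc_of_ge hij] at h
    exact Or.inr ⟨⟨j, h ▸ isLeast_Icc hij, rfl⟩, ⟨i, h ▸ isGreatest_Icc hij, rfl⟩⟩

variable (Γ) in
/-- `y` lies on some geodesic between `a` and `b`. -/
def Between (a y b : V) : Prop := Γ.dist a y + Γ.dist y b = Γ.dist a b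

theorem Between.symm {a y b : V} (h : Between Γ a y b) : Between Γ b y a := by
  unfold Between at *
  rw [SimpleGraph.dist_comm (u := b) (v := y), SimpleGraph.dist_comm (u := y) (v := a),
    SimpleGraph.dist_comm (u := b) (v := a)]
  omega

theorem Between.trans_right (hconn : Γ.Connected) {a y z b : V} (h : Between Γ a y b)
    (h' : Between Γ a z y) : Between Γ a z b := by
  unfold Between at *
  have h1 := hconn.dist_triangle (u := z) (v := y) (w := b)
  have h2 := hconn.dist_triangle (u := a) (v := z) (w := b)
  omega

theorem Between.trans_left (hconn : Γ.Connected) {a y z b : V} (h : Between Γ a y b)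
    (h' : Between Γ y z b) : Between Γ a z b :=
  (h.symm.trans_right hconn h'.symm).symm

theorem Geodesic.Joins.between {c : Geodesic Γ} {a b x : V}
    (h : c.Joins (Sum.inl a) (Sum.inl b)) (hx : x ∈ c.support) : Between Γ a x b := by
  obtain ⟨i, j, hd, rfl, rfl⟩ := h.exists_uIcc
  obtain ⟨k, hk, rfl⟩ := hx
  have hi : i ∈ c.dom := hd ▸ Set.left_mem_uIcc
  have hj : j ∈ c.dom := hd ▸ Set.right_mem_uIcc
  have h1 := c.dist_eq i hi k hk
  have h2 := c.dist_eq k hk j hj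
  have h3 := c.dist_eq i hi j hj
  rw [hd, Set.mem_uIcc] at hk
  unfold Between
  rcases hk with ⟨hk, hk'⟩ | ⟨hk, hk'⟩
  · rw [abs_of_nonpos (by omega)] at h1 h2 h3; omega
  · rw [abs_of_nonneg (by omega)] at h1 h2 h3; omega

theorem Geodesic.Joins.left_mem_support {c : Geodesic Γ} {a b : V}
    (h : c.Joins (Sum.inl a) (Sum.inl b)) : a ∈ c.support := by
  obtain ⟨i, j, hd, rfl, rfl⟩ := h.exists_uIcc
  exact ⟨i, hd ▸ Set.left_mem_uIcc, rfl⟩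

theorem Geodesic.Joins.symm {c : Geodesic Γ} {ξ ξ' : Endpoint Γ} (h : c.Joins ξ ξ') :
    c.Joins ξ' ξ :=
  Or.symm h

theorem SmallJoined.symm {d : ℝ} {Θ : Set (Sym2 (Sym2 V))} {a b : V}
    (h : SmallJoined Γ d Θ a b) : SmallJoined Γ d Θ b a :=
  ⟨by rw [SimpleGraph.dist_comm]; exact h.1, h.2.imp fun _ hc => ⟨hc.1.symm, hc.2⟩⟩

/-- A terminal segment of a small geodesic is small. -/
theorem Geodesic.Joins.smallJoined_of_mem_support {c : Geodesic Γ} {d : ℝ}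
    {Θ : Set (Sym2 (Sym2 V))} {a b x : V} (h : c.Joins (Sum.inl a) (Sum.inl b))
    (hc : c.IsSmall Θ) (hd : (Γ.dist a b : ℝ) ≤ d) (hx : x ∈ c.support) :
    SmallJoined Γ d Θ x b := by
  have hbt : Between Γ a x b := h.between hx
  refine ⟨le_trans (by exact_mod_cast (by unfold Between at hbt; omega)) hd, ?_⟩
  obtain ⟨i, j, hdom, rfl, rfl⟩ := h.exists_uIcc
  obtain ⟨k, hk, rfl⟩ := hx
  have hsub : Set.uIcc k j ⊆ c.dom := by
    rw [hdom] at hk ⊢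
    exact Set.uIcc_subset_uIcc hk Set.right_mem_uIcc
  let c' : Geodesic Γ :=
    { dom := Set.uIcc k j
      toFun := c.toFun
      nonempty := Set.nonempty_uIcc
      ordConnected := Set.ordConnected_uIcc
      dist_eq := fun m hm n hn => c.dist_eq m (hsub hm) n (hsub hn) }
  exact ⟨c', Geodesic.joins_of_dom_eq (c := c') rfl,
    fun m hm hm' => hc m (hsub hm) (hsub hm')⟩

variable (Γ) in
/-- `p` is the first vertex after `w` on some geodesic from `w` to `a`. -/
def Toward (w p a : V) : Prop := Γ.Adj w p ∧ Γ.dist p a + 1 = Γ.dist w a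

theorem Toward.dist_pos {w p a : V} (h : Toward Γ w p a) : 0 < Γ.dist w a := by
  have := h.2; omega

theorem Toward.ne {w p a : V} (h : Toward Γ w p a) : w ≠ a := by
  rintro rfl
  simpa using h.dist_pos

theorem Toward.exists_geodesic (hconn : Γ.Connected) {w p a : V} (h : Toward Γ w p a) :
    ∃ c : Geodesic Γ, c.HasSource (Sum.inl w) ∧ c.HasTarget (Sum.inl a) ∧
      c.HasInitialEdge w s(w, p) := by
  obtain ⟨q, hq⟩ := hconn.exists_walk_length_eq_dist p a
  have hl : (SimpleGraph.Walk.cons h.1 q).length = Γ.dist w a := by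
    rw [SimpleGraph.Walk.length_cons, hq, h.2]
  refine ⟨_, Geodesic.ofWalk_hasSource hconn _ hl, Geodesic.ofWalk_hasTarget hconn _ hl,
    0, isLeast_Icc (by positivity), by simp [Geodesic.ofWalk], ?_, ?_⟩
  · simp [Geodesic.ofWalk]
  · simp [Geodesic.ofWalk]

theorem exists_toward (hconn : Γ.Connected) {w a : V} (h : w ≠ a) : ∃ p, Toward Γ w p a := by
  obtain ⟨q, hq⟩ := hconn.exists_walk_length_eq_dist w a
  cases q with
  | nil => exact absurd rfl h
  | @cons _ p _ hadj q =>
    refine ⟨p, hadj, ?_⟩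
    have h1 := Γ.dist_le q
    have h2 := hconn.dist_triangle (u := w) (v := p) (w := a)
    have h3 := SimpleGraph.dist_eq_one_iff_adj.2 hadj
    rw [SimpleGraph.Walk.length_cons] at hq
    omega

/-- A geodesic from w to a can be prolonged to b through a, and keeps its first edge. -/
theorem Toward.extend (hconn : Γ.Connected) {w p a b : V} (h : Toward Γ w p a)
    (hb : Between Γ w a b) : Toward Γ w p b := by
  refine ⟨h.1, ?_⟩
  have h1 := hconn.dist_triangle (u := p) (v := a) (w := b)
  have h2 := hconn.dist_triangle (u := w) (v := p) (w := b)
  have h3 := SimpleGraph.dist_eq_one_iff_adj.2 h.1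
  have h4 := h.2
  unfold Between at hb
  omega

/-- Geodesics between `a` and `b` are small if all angles occurring on them are in `Θ`. -/
theorem smallJoined_of_forall_toward (hconn : Γ.Connected) {d : ℝ} {Θ : Set (Sym2 (Sym2 V))}
    {a b : V} (hd : (Γ.dist a b : ℝ) ≤ d)
    (h : ∀ y p q, Between Γ a y b → Toward Γ y p a → Toward Γ y q b →
      s(s(y, p), s(y, q)) ∈ Θ) : SmallJoined Γ d Θ a b := by
  refine ⟨hd, ?_⟩
  obtain ⟨c, ⟨i, hi, hia⟩, j, hj, hjb⟩ := RelRips.exists_geodesic hconn a b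
  have hdom := Geodesic.dom_eq_Icc hi hj
  have hJ : c.Joins (Sum.inl a) (Sum.inl b) := Or.inl ⟨⟨i, hi, hia⟩, j, hj, hjb⟩
  refine ⟨c, hJ, fun k hk hk' => ?_⟩
  have hk0 : k ∈ c.dom := c.ordConnected.out hk hk' ⟨by omega, by omega⟩
  rw [Sym2.eq_swap (a := c.toFun (k - 1))]
  have hik := hi.2 hk
  have hjk := hj.2 hk'
  have e1 := c.dist_eq k hk0 (k - 1) hk
  have e2 := c.dist_eq k hk0 (k + 1) hk'
  have e3 := c.dist_eq k hk0 i hi.1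
  have e4 := c.dist_eq (k - 1) hk i hi.1
  have e5 := c.dist_eq k hk0 j hj.1
  have e6 := c.dist_eq (k + 1) hk' j hj.1
  rw [abs_of_nonneg (by omega)] at e1 e3 e4
  rw [abs_of_nonpos (by omega)] at e2 e5 e6
  refine h _ _ _ (hJ.between ⟨k, hk0, rfl⟩) ⟨?_, ?_⟩ ⟨?_, ?_⟩
  · rw [← SimpleGraph.dist_eq_one_iff_adj]; omega
  · rw [← hia]; omega
  · rw [← SimpleGraph.dist_eq_one_iff_adj]; omega
  · rw [← hjb]; omega

/-! ### Angles of geodesic triangles -/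

variable (Γ) in
/-- The edges from `w` to `p` and `q` form an angle in `Θ⁽³⁾`. -/
def ThreeAngle (w p q : V) : Prop :=
  Γ.Adj w p ∧ Γ.Adj w q ∧ s(s(w, p), s(w, q)) ∈ thetaThree Γ

theorem ThreeAngle.symm {w p q : V} (h : ThreeAngle Γ w p q) : ThreeAngle Γ w q p :=
  ⟨h.2.1, h.1, by rw [Sym2.eq_swap]; exact h.2.2⟩

theorem threeAngle_of_notMem_support (hconn : Γ.Connected) {w p q a b : V} (hp : Toward Γ w p a)
    (hq : Toward Γ w q b) {c : Geodesic Γ} (hc : c.Joins (Sum.inl a) (Sum.inl b))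
    (hw : w ∉ c.support) : ThreeAngle Γ w p q := by
  obtain ⟨c₁, h₁, h₁', h₁''⟩ := hp.exists_geodesic hconn
  obtain ⟨c₂, h₂, h₂', h₂''⟩ := hq.exists_geodesic hconn
  exact ⟨hp.1, hq.1, w, _, _, c₁, c₂, c, _, _, h₁, h₁', h₂, h₂', hc, hw, h₁'', h₂'', rfl⟩

/-- Any geodesic from a to b misses w and closes up a triangle. Mostly used in contrapositive form,
to place w on a geodesic. -/
theorem threeAngle_of_not_between (hconn : Γ.Connected) {w p q a b : V} (hp : Toward Γ w p a)
    (hq : Toward Γ w q b) (hw : ¬ Between Γ a w b) : ThreeAngle Γ w p q := by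
  obtain ⟨c, hc, hc'⟩ := RelRips.exists_geodesic hconn a b
  exact threeAngle_of_notMem_support hconn hp hq (Or.inl ⟨hc, hc'⟩)
    fun h => hw (Geodesic.Joins.between (Or.inl ⟨hc, hc'⟩) h)

/-- Degenerate triangle: both other corners are p, and the opposite side is constant. This makes the
sets nΘ⁽³⁾ increasing in n. -/
theorem threeAngle_self {w p : V} (hconn : Γ.Connected) (h : Γ.Adj w p) :
    ThreeAngle Γ w p p := by
  have ht : Toward Γ w p p := ⟨h, by simp [SimpleGraph.dist_eq_one_iff_adj.2 h]⟩
  refine threeAngle_of_not_between hconn ht ht fun hb => ?_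
  have h1 := SimpleGraph.dist_eq_one_iff_adj.2 h
  unfold Between at hb
  rw [SimpleGraph.dist_self] at hb
  omega

variable (Γ) in
/-- The edges from `w` to `p` and `q` form an angle in `nΘ⁽³⁾`, with all intermediate edges
starting in `w`. -/
def ChainAngle (w : V) : ℕ → V → V → Prop
  | 0, p, q => Γ.Adj w p ∧ p = q
  | n + 1, p, q => ∃ r, ChainAngle w n p r ∧ ThreeAngle Γ w r q

theorem ChainAngle.adj {w p q : V} {n : ℕ} (h : ChainAngle Γ w n p q) :
    Γ.Adj w p ∧ Γ.Adj w q := by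
  induction n generalizing q with
  | zero => exact ⟨h.1, h.2 ▸ h.1⟩
  | succ n ih =>
    obtain ⟨r, hr, hrq⟩ := h
    exact ⟨(ih hr).1, hrq.2.1⟩

theorem ThreeAngle.chainAngle {w p q : V} (h : ThreeAngle Γ w p q) : ChainAngle Γ w 1 p q :=
  ⟨p, ⟨h.1, rfl⟩, h⟩

theorem ChainAngle.trans {w p q r : V} {m n : ℕ} (h : ChainAngle Γ w m p q)
    (h' : ChainAngle Γ w n q r) : ChainAngle Γ w (m + n) p r := by
  induction n generalizing r with
  | zero => exact h'.2 ▸ h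
  | succ n ih =>
    obtain ⟨t, ht, htr⟩ := h'
    exact ⟨t, ih ht, htr⟩

theorem ChainAngle.symm {w p q : V} {n : ℕ} (h : ChainAngle Γ w n p q) :
    ChainAngle Γ w n q p := by
  induction n generalizing q with
  | zero => exact ⟨h.adj.2, h.2.symm⟩
  | succ n ih =>
    obtain ⟨r, hr, hrq⟩ := h
    rw [Nat.add_comm]
    exact hrq.symm.chainAngle.trans (ih hr)

theorem ChainAngle.mono (hconn : Γ.Connected) {w p q : V} {m n : ℕ} (hmn : m ≤ n)
    (h : ChainAngle Γ w m p q) : ChainAngle Γ w n p q := by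
  induction n, hmn using Nat.le_induction with
  | base => exact h
  | succ n _ ih => exact ⟨q, ih, threeAngle_self hconn h.adj.2⟩

theorem ChainAngle.mem_angleMultiple {w p q : V} {n : ℕ} (h : ChainAngle Γ w n p q) :
    s(s(w, p), s(w, q)) ∈ angleMultiple Γ (thetaThree Γ) n := by
  induction n generalizing q with
  | zero => exact ⟨s(w, p), h.1, by rw [← h.2]⟩
  | succ n ih =>
    obtain ⟨r, hr, hrq⟩ := h
    exact ⟨⟨s(w, p), hr.adj.1, s(w, q), hrq.2.1, ⟨w, by simp, by simp⟩, rfl⟩,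
      s(w, p), s(w, q), rfl, s(w, r), hrq.1, ih hr, hrq.2.2⟩

end FiniteGeodesics

/-! ### Moving a vertex towards a base point -/

section Move

variable {V : Type*} {Γ : SimpleGraph V}

variable (Γ) in
/-- Geodesics from `u` to `x₀` may have an angle outside `2Θ⁽³⁾` at `y`. -/
def LargeAt (x₀ u y : V) : Prop :=
  Between Γ u y x₀ ∧ ∃ p q, Toward Γ y p u ∧ Toward Γ y q x₀ ∧ ¬ ChainAngle Γ y 2 p q

theorem smallJoined_of_largeAt (hconn : Γ.Connected) {Θ : Set (Sym2 (Sym2 V))}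
    (hΘ : ∀ y p q, ChainAngle Γ y 4 p q → s(s(y, p), s(y, q)) ∈ Θ) {d : ℝ} {x₀ u v w : V}
    (hw : LargeAt Γ x₀ v w) (hd : (Γ.dist u x₀ : ℝ) ≤ d + Γ.dist w x₀)
    (hmax : ∀ y, LargeAt Γ x₀ u y → Γ.dist y x₀ ≤ Γ.dist w x₀)
    (hu : SmallJoined Γ d Θ v u) : SmallJoined Γ d Θ w u := by
  obtain ⟨hvu, h, hh, hsmall⟩ := hu
  by_cases hws : w ∈ h.support
  · exact hh.smallJoined_of_mem_support hsmall hvu hws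
  obtain ⟨_, p, q, hp, hq, hpq⟩ := hw
  have hwu : w ≠ u := by
    rintro rfl
    exact hws hh.symm.left_mem_support
  obtain ⟨r, hr⟩ := exists_toward hconn hwu
  have hpr := threeAngle_of_notMem_support hconn hp hr hh hws
  -- Otherwise the direction r towards u is within Θ⁽³⁾ of both p and q, and the angle (p, q) would
  -- not be large.
  have hbt : Between Γ u w x₀ := by
    by_contra hcon
    exact hpq (hpr.chainAngle.trans (threeAngle_of_not_between hconn hr hq hcon).chainAngle)
  have hbt' := hbt
  unfold Between at hbt'
  have hdwu : (Γ.dist w u : ℝ) ≤ d := by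
    rw [SimpleGraph.dist_comm]
    have : (Γ.dist u w : ℝ) + Γ.dist w x₀ = Γ.dist u x₀ := by exact_mod_cast hbt'
    linarith
  refine smallJoined_of_forall_toward hconn hdwu fun y p' q' hy hp' hq' => hΘ _ _ _ ?_
  have hyx : Between Γ y w x₀ := by
    have h1 := hconn.dist_triangle (u := y) (v := w) (w := x₀)
    have h2 := hconn.dist_triangle (u := u) (v := y) (w := x₀)
    have h3 := hy.symm
    unfold Between at h3 ⊢
    omega
  -- An internal vertex of a geodesic from w to u is strictly farther from x₀ than w, against the
  -- maximality of w.
  have hlarge : ¬ LargeAt Γ x₀ u y := by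
    intro hl
    have h1 := hmax y hl
    have h2 := hp'.dist_pos
    unfold Between at hyx
    omega
  by_contra hcon
  refine hlarge ⟨hbt.trans_right hconn hy.symm, q', p', hq', hp'.extend hconn hyx, fun hc => ?_⟩
  exact hcon (hc.symm.mono hconn (by norm_num))

theorem smallJoined_base (hconn : Γ.Connected) {Θ : Set (Sym2 (Sym2 V))}
    (hΘ : ∀ y p q, ChainAngle Γ y 4 p q → s(s(y, p), s(y, q)) ∈ Θ) {d : ℝ} {x₀ u : V}
    (hd : (Γ.dist u x₀ : ℝ) ≤ d) (hl : ∀ y, ¬ LargeAt Γ x₀ u y) :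
    SmallJoined Γ d Θ x₀ u := by
  refine SmallJoined.symm (smallJoined_of_forall_toward hconn hd fun y p q hy hp hq => ?_)
  refine hΘ _ _ _ ?_
  by_contra hcon
  exact hl y ⟨hy, p, q, hp, hq, fun hc => hcon (hc.mono hconn (by norm_num))⟩

/-- v' is δ-close to some y on one of the other two sides. If y is on the side from x₀ to u, then
d(y,u) ≤ 3δ because u is no farther from x₀ than v. If y is on the side from v to u, then d(v,y) ≥ δ
pays for the detour from v' to y. -/
theorem dist_le_of_hyperbolic (hconn : Γ.Connected) {δ : ℕ} (hδ : IsHyperbolicityConstant Γ δ)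
    {d : ℝ} (hd : 4 * (δ : ℝ) ≤ d) {x₀ u v v' : V} {c : Geodesic Γ}
    (hc : c.Joins (Sum.inl v) (Sum.inl x₀)) (hv' : v' ∈ c.support)
    (hvv' : Γ.dist v v' = 2 * δ) (hux : Γ.dist u x₀ ≤ Γ.dist v x₀)
    (hvu : (Γ.dist v u : ℝ) ≤ d) : (Γ.dist v' u : ℝ) ≤ d := by
  obtain ⟨c', hc', hc''⟩ := exists_geodesic hconn x₀ u
  obtain ⟨e, he, he'⟩ := exists_geodesic hconn v u
  have hbt : Γ.dist v v' + Γ.dist v' x₀ = Γ.dist v x₀ := hc.between hv'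
  obtain ⟨y, hy, hyd⟩ := hδ _ _ (Sum.inl u) c c' e hc (Or.inl ⟨hc', hc''⟩) (Or.inl ⟨he, he'⟩)
    v' hv'
  have h1 := hconn.dist_triangle (u := v') (v := y) (w := u)
  rcases hy with hy | hy
  · have h2 : Γ.dist x₀ y + Γ.dist y u = Γ.dist x₀ u :=
      Geodesic.Joins.between (Or.inl ⟨hc', hc''⟩) hy
    have h3 := hconn.dist_triangle (u := v') (v := y) (w := x₀)
    rw [SimpleGraph.dist_comm (u := y) (v := x₀)] at h3
    rw [SimpleGraph.dist_comm (u := u)] at hux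
    have h4 : Γ.dist v' u ≤ 4 * δ := by omega
    have h5 : (Γ.dist v' u : ℝ) ≤ 4 * δ := by exact_mod_cast h4
    linarith
  · have h2 : Γ.dist v y + Γ.dist y u = Γ.dist v u :=
      Geodesic.Joins.between (Or.inl ⟨he, he'⟩) hy
    have h3 := hconn.dist_triangle (u := v) (v := y) (w := v')
    rw [SimpleGraph.dist_comm (u := y) (v := v')] at h3
    have h4 : Γ.dist v' u ≤ Γ.dist v u := by omega
    exact le_trans (by exact_mod_cast h4) hvu

/-- At y, compare the directions p, q with directions a towards v and b towards x₀. Each comparison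
costs Θ⁽³⁾ unless y lies on the corresponding geodesic, in which case `hlu` and `hlv` exclude large
angles as soon as y is far enough from x₀. The worst case is y between v' and x₀, where p to b and b
to q cost 2Θ⁽³⁾ each. -/
theorem chainAngle_of_not_largeAt (hconn : Γ.Connected) {δ : ℕ} {d : ℝ} (hd : 4 * (δ : ℝ) ≤ d)
    {x₀ u v v' y p q : V} (hv' : Between Γ v v' x₀) (hvv' : Γ.dist v v' = 2 * δ)
    (hux : Γ.dist u x₀ ≤ Γ.dist v x₀) (hvx : d < Γ.dist v x₀) (hvu : (Γ.dist v u : ℝ) ≤ d)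
    (hlu : ∀ y, LargeAt Γ x₀ u y → (Γ.dist y x₀ : ℝ) + d < Γ.dist v x₀)
    (hlv : ∀ y, LargeAt Γ x₀ v y → (Γ.dist y x₀ : ℝ) + d < Γ.dist v x₀)
    (hp : Toward Γ y p v') (hq : Toward Γ y q u) : ChainAngle Γ y 4 p q := by
  by_contra hcon
  have hn : ∀ m ≤ 4, ¬ ChainAngle Γ y m p q := fun m hm hc => hcon (hc.mono hconn hm)
  have hnT : ¬ ThreeAngle Γ y p q := fun h => hn 1 (by norm_num) h.chainAngle
  have hsplit {a b : V} {e f : V} (he : Toward Γ y e a) (hf : Toward Γ y f b)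
      (h : ¬ ThreeAngle Γ y e f) : Between Γ a y b := by
    by_contra hb
    exact h (threeAngle_of_not_between hconn he hf hb)
  have hclose (h : Between Γ v y u) : (Γ.dist v x₀ : ℝ) ≤ Γ.dist y x₀ + d := by
    have h1 := hconn.dist_triangle (u := v) (v := y) (w := x₀)
    unfold Between at h
    have h2 : Γ.dist v x₀ ≤ Γ.dist y x₀ + Γ.dist v u := by omega
    have h3 : (Γ.dist v x₀ : ℝ) ≤ Γ.dist y x₀ + Γ.dist v u := by exact_mod_cast h2
    linarith
  -- Either y is not between u and x₀, which costs one Θ⁽³⁾, or it is, and then the angle there is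
  -- not large.
  have hnotlarge (h : (Γ.dist v x₀ : ℝ) ≤ Γ.dist y x₀ + d) (e : V) (he : Toward Γ y e x₀) :
      ChainAngle Γ y 2 q e := by
    by_contra hc
    have hb : Between Γ u y x₀ := hsplit hq he
      fun h => hc (h.chainAngle.mono hconn (by norm_num))
    exact absurd (hlu y ⟨hb, q, e, hq, he, hc⟩) (not_lt.2 h)
  by_cases hyv : y = v
  · subst hyv
    have h1 : Between Γ x₀ y u := hsplit (hp.extend hconn hv') hq hnT
    have h2 := hq.dist_pos
    unfold Between at h1
    rw [SimpleGraph.dist_comm (u := x₀), SimpleGraph.dist_comm (u := x₀)] at h1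
    omega
  by_cases hyx : y = x₀
  · subst hyx
    have h1 : Between Γ v y u := hsplit (hp.extend hconn hv'.symm) hq hnT
    unfold Between at h1
    have h2 : Γ.dist v y ≤ Γ.dist v u := by omega
    have h3 : (Γ.dist v y : ℝ) ≤ Γ.dist v u := by exact_mod_cast h2
    linarith
  obtain ⟨a, ha⟩ := exists_toward hconn hyv
  obtain ⟨b, hb⟩ := exists_toward hconn hyx
  by_cases h4 : Between Γ v y v'
  · have hyv' : Between Γ y v' x₀ := by
      have h1 := hconn.dist_triangle (u := v) (v := y) (w := x₀)
      have h2 := hconn.dist_triangle (u := y) (v := v') (w := x₀)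
      unfold Between at *
      omega
    refine hn 2 (by norm_num) (hnotlarge ?_ p (hp.extend hconn hyv')).symm
    have h2 : Γ.dist v x₀ ≤ Γ.dist y x₀ + 4 * δ := by
      unfold Between at *
      omega
    have h3 : (Γ.dist v x₀ : ℝ) ≤ Γ.dist y x₀ + 4 * δ := by exact_mod_cast h2
    linarith
  by_cases h5 : Between Γ v' y x₀
  · have hyv' : Between Γ v v' y := by
      have h1 := hconn.dist_triangle (u := v) (v := y) (w := x₀)
      have h2 := hconn.dist_triangle (u := v) (v := v') (w := y)
      unfold Between at *
      omega
    have hpv := hp.extend hconn hyv'.symm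
    have hc := hclose (hsplit hpv hq hnT)
    have hpb : ChainAngle Γ y 2 p b := by
      by_contra h
      exact absurd (hlv y ⟨hv'.trans_left hconn h5, p, b, hpv, hb, h⟩) (not_lt.2 hc)
    exact hcon (hpb.trans (hnotlarge hc b hb).symm)
  -- Here y is on neither part of the way from v to x₀ through v', so p is within Θ⁽³⁾ of both a and
  -- b. If y is not between v and u, passing through a costs 2Θ⁽³⁾; if it is, passing through b
  -- costs 3Θ⁽³⁾.
  · have hpa : ThreeAngle Γ y p a :=
      threeAngle_of_not_between hconn hp ha fun h => h4 h.symm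
    have hpb : ThreeAngle Γ y p b := threeAngle_of_not_between hconn hp hb h5
    have hvu' : Between Γ v y u := hsplit ha hq
      fun h => hn 2 (by norm_num) (hpa.chainAngle.trans h.chainAngle)
    exact hn 3 (by norm_num) (hpb.chainAngle.trans (hnotlarge (hclose hvu') b hb).symm)

/-- In a finite set of vertices different from `{x₀}`, some vertex can be moved towards `x₀`
without destroying any edge of the relative Rips complex. -/
theorem exists_move (hconn : Γ.Connected) {δ : ℕ} (hδpos : 0 < δ)
    (hδ : IsHyperbolicityConstant Γ δ) {Θ : Set (Sym2 (Sym2 V))}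
    (hΘ : ∀ y p q, ChainAngle Γ y 4 p q → s(s(y, p), s(y, q)) ∈ Θ) {d : ℝ}
    (hd : 4 * (δ : ℝ) ≤ d) (x₀ : V) (S : Finset V) (hS : ∃ u ∈ S, u ≠ x₀) :
    ∃ v ∈ S, ∃ v', Between Γ v v' x₀ ∧ Γ.dist v' x₀ < Γ.dist v x₀ ∧
      ∀ u ∈ S, SmallJoined Γ d Θ v u → SmallJoined Γ d Θ v' u := by
  obtain ⟨u₀, hu₀, hu₀x⟩ := hS
  obtain ⟨v, hv, hmax⟩ := S.exists_max_image (fun u => Γ.dist u x₀) ⟨u₀, hu₀⟩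
  have hvpos : 0 < Γ.dist v x₀ := (hconn.pos_dist_of_ne hu₀x).trans_le (hmax _ hu₀)
  have hmaxR : ∀ u ∈ S, (Γ.dist u x₀ : ℝ) ≤ Γ.dist v x₀ := fun u hu => by
    exact_mod_cast hmax u hu
  by_cases hA : ∃ u ∈ S, ∃ y, LargeAt Γ x₀ u y ∧ (Γ.dist v x₀ : ℝ) ≤ d + Γ.dist y x₀
  · let N : Set ℕ := {n | ∃ u ∈ S, ∃ y, LargeAt Γ x₀ u y ∧
      (Γ.dist v x₀ : ℝ) ≤ d + Γ.dist y x₀ ∧ Γ.dist y x₀ = n}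
    have hbdd : BddAbove N := by
      refine ⟨Γ.dist v x₀, ?_⟩
      rintro n ⟨u, hu, y, hy, -, rfl⟩
      have h1 := hmax u hu
      have h2 := hy.1
      unfold Between at h2
      omega
    have hne : N.Nonempty := by
      obtain ⟨u, hu, y, hy, hyd⟩ := hA
      exact ⟨_, u, hu, y, hy, hyd, rfl⟩
    obtain ⟨u, hu, w, hw, hwd, hwn⟩ := Nat.sSup_mem hne hbdd
    refine ⟨u, hu, w, hw.1, ?_, fun u' hu' hj => ?_⟩
    · obtain ⟨hb, p, q, hp, -, -⟩ := hw
      have h1 := hp.dist_pos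
      rw [SimpleGraph.dist_comm] at h1
      unfold Between at hb
      omega
    · refine smallJoined_of_largeAt hconn hΘ hw ((hmaxR u' hu').trans hwd) (fun y hy => ?_) hj
      by_contra! hlt
      have hltR : (Γ.dist w x₀ : ℝ) < Γ.dist y x₀ := by exact_mod_cast hlt
      have := le_csSup hbdd (show Γ.dist y x₀ ∈ N from ⟨u', hu', y, hy, by linarith, rfl⟩)
      omega
  · push Not at hA
    rcases le_or_gt (Γ.dist v x₀ : ℝ) d with hvd | hvd
    · refine ⟨v, hv, x₀, by simp [Between], by simpa using hvpos, fun u hu _ => ?_⟩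
      refine smallJoined_base hconn hΘ ((hmaxR u hu).trans hvd) fun y hy => ?_
      have h1 := hA u hu y hy
      have h2 : (0 : ℝ) ≤ Γ.dist y x₀ := by positivity
      linarith
    · obtain ⟨c, ⟨i, hi, hiv⟩, j, hj, hjx⟩ := exists_geodesic hconn v x₀
      have hc : c.Joins (Sum.inl v) (Sum.inl x₀) := Or.inl ⟨⟨i, hi, hiv⟩, j, hj, hjx⟩
      have hlen := c.dist_eq i hi.1 j hj.1
      have hij := hi.2 hj.1
      rw [abs_of_nonpos (by omega), hiv, hjx] at hlen
      have h4 : 4 * δ < Γ.dist v x₀ := by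
        have : (4 * (δ : ℝ)) < Γ.dist v x₀ := by linarith
        exact_mod_cast this
      -- The geodesic is longer than 4δ, so the point at distance 2δ from v exists.
      have hk : i + 2 * δ ∈ c.dom := by
        rw [Geodesic.dom_eq_Icc hi hj]
        constructor <;> omega
      have hvk := c.dist_eq i hi.1 _ hk
      rw [abs_of_nonpos (by omega), hiv] at hvk
      have hsup : c.toFun (i + 2 * δ) ∈ c.support := ⟨_, hk, rfl⟩
      have hbt := hc.between hsup
      have hvv' : Γ.dist v (c.toFun (i + 2 * δ)) = 2 * δ := by omega
      refine ⟨v, hv, c.toFun (i + 2 * δ), hbt, ?_, fun u hu hj => ?_⟩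
      · unfold Between at hbt
        omega
      · have hl : ∀ u ∈ S, ∀ y, LargeAt Γ x₀ u y → (Γ.dist y x₀ : ℝ) + d < Γ.dist v x₀ :=
          fun u hu y hy => by rw [add_comm]; exact hA u hu y hy
        exact smallJoined_of_forall_toward hconn
          (dist_le_of_hyperbolic hconn hδ hd hc hsup hvv' (hmax u hu) hj.1)
          fun y p q _ hp hq => hΘ _ _ _ (chainAngle_of_not_largeAt hconn hd hbt hvv' (hmax u hu)
            hvd hj.1 (hl u hu) (hl v hv) hp hq)

end Move

end RelRips

namespace RelRips

/-! ### Maps into realizations in barycentric coordinates -/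

section Coordinates

universe u

variable {V : Type u}

theorem face_nonempty {Q : PreAbstractSimplicialComplex V} {s : Finset V} (hs : s ∈ Q.faces) :
    s.Nonempty :=
  (Q.isRelLowerSet_faces hs).1

theorem face_of_subset {Q : PreAbstractSimplicialComplex V} {s t : Finset V} (hs : s ∈ Q.faces)
    (hts : t ⊆ s) (ht : t.Nonempty) : t ∈ Q.faces :=
  (Q.isRelLowerSet_faces hs).2 hts ht

theorem closedSimplex_of_vanish {s t : Finset V} {x : V → ℝ} (hx : x ∈ closedSimplex s)
    (ht : ∀ v, v ∉ t → x v = 0) : x ∈ closedSimplex t := by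
  classical
  refine ⟨hx.1, ht, ?_⟩
  rw [← hx.2.2, Finset.sum_subset (Finset.subset_union_left (s₂ := s)) fun v _ hv => ht v hv,
    Finset.sum_subset (Finset.subset_union_right (s₁ := t)) fun v _ hv => hx.2.1 v hv]

theorem closedSimplex_mono {s t : Finset V} (h : s ⊆ t) : closedSimplex s ⊆ closedSimplex t :=
  fun _ hx => closedSimplex_of_vanish hx fun v hv => hx.2.1 v fun hs => hv (h hs)

theorem nonempty_of_mem_closedSimplex {s : Finset V} {x : V → ℝ} (hx : x ∈ closedSimplex s) :
    s.Nonempty := by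
  rw [Finset.nonempty_iff_ne_empty]
  rintro rfl
  simpa using hx.2.2

theorem convex_closedSimplex (s : Finset V) : Convex ℝ (closedSimplex s) := by
  intro x hx y hy a b ha hb hab
  refine ⟨fun v => ?_, fun v hv => ?_, ?_⟩
  · exact add_nonneg (mul_nonneg ha (hx.1 v)) (mul_nonneg hb (hy.1 v))
  · simp [hx.2.1 v hv, hy.2.1 v hv]
  · simp [Finset.sum_add_distrib, ← Finset.mul_sum, hx.2.2, hy.2.2, hab]

theorem isClosed_closedSimplex (s : Finset V) : IsClosed (closedSimplex s) := by
  have h : closedSimplex s = (⋂ v, {x : V → ℝ | 0 ≤ x v}) ∩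
      ((⋂ v, ⋂ (_ : v ∉ s), {x : V → ℝ | x v = 0}) ∩ {x : V → ℝ | ∑ v ∈ s, x v = 1}) := by
    ext x
    simp [closedSimplex]
  rw [h]
  refine (isClosed_iInter fun v => ?_).inter
    ((isClosed_iInter fun v => isClosed_iInter fun _ => ?_).inter ?_)
  · exact isClosed_le continuous_const (continuous_apply v)
  · exact isClosed_eq (continuous_apply v) continuous_const
  · exact isClosed_eq (continuous_finsetSum _ fun v _ => continuous_apply v) continuous_const

theorem le_one_of_mem_closedSimplex {s : Finset V} {x : V → ℝ} (hx : x ∈ closedSimplex s)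
    (v : V) : x v ≤ 1 := by
  by_cases hv : v ∈ s
  · rw [← hx.2.2]
    exact Finset.single_le_sum (f := x) (fun w _ => hx.1 w) hv
  · rw [hx.2.1 v hv]
    exact zero_le_one

theorem isCompact_closedSimplex (s : Finset V) : IsCompact (closedSimplex s) :=
  (isCompact_univ_pi fun _ : V => isCompact_Icc (a := (0 : ℝ)) (b := 1)).of_isClosed_subset
    (isClosed_closedSimplex s) fun _ hx v _ => ⟨hx.1 v, le_one_of_mem_closedSimplex hx v⟩

theorem single_mem_closedSimplex [DecidableEq V] (v : V) :
    (Pi.single v 1 : V → ℝ) ∈ closedSimplex {v} := by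
  refine ⟨fun w => ?_, fun w hw => ?_, by simp⟩
  · rcases eq_or_ne w v with rfl | h
    · simp
    · simp [h]
  · simp at hw
    simp [hw]

theorem eq_single_of_mem_closedSimplex [DecidableEq V] {v : V} {x : V → ℝ}
    (hx : x ∈ closedSimplex {v}) : x = Pi.single v 1 := by
  ext w
  rcases eq_or_ne w v with rfl | h
  · simpa using hx.2.2
  · simpa [h] using hx.2.1 w (by simpa using h)

/-- `x` is a point of the realization of `Q`. -/
def InComplex (Q : PreAbstractSimplicialComplex V) (x : V → ℝ) : Prop :=
  ∃ s ∈ Q.faces, x ∈ closedSimplex s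

/-- Intersecting a carrier with S loses no nonzero coordinate. Hence only the finitely many faces
inside S matter. -/
theorem InComplex.exists_face_subset {Q : PreAbstractSimplicialComplex V} {x : V → ℝ}
    (hx : InComplex Q x) {S : Finset V} (hS : ∀ v, v ∉ S → x v = 0) :
    ∃ s ∈ Q.faces, s ⊆ S ∧ x ∈ closedSimplex s := by
  classical
  obtain ⟨s, hs, hxs⟩ := hx
  have hx' : x ∈ closedSimplex (s ∩ S) := closedSimplex_of_vanish hxs fun v hv => by
    by_cases h : v ∈ S
    · exact hxs.2.1 v fun h' => hv (Finset.mem_inter.2 ⟨h', h⟩)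
    · exact hS v h
  exact ⟨s ∩ S, face_of_subset hs Finset.inter_subset_left (nonempty_of_mem_closedSimplex hx'),
    Finset.inter_subset_right, hx'⟩

theorem continuous_ofSimplex (Q : PreAbstractSimplicialComplex V) (s : Q.faces) :
    Continuous (Realization.ofSimplex Q s) :=
  ⟨fun U hU => (Realization.isOpen_iff Q U).1 hU s⟩

theorem Realization.continuous_of_forall {Y : Type*} [TopologicalSpace Y]
    {Q : PreAbstractSimplicialComplex V} {f : Realization Q → Y}
    (h : ∀ s : Q.faces, Continuous (f ∘ Realization.ofSimplex Q s)) : Continuous f :=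
  ⟨fun U hU => (Realization.isOpen_iff Q _).2 fun s => (h s).isOpen_preimage U hU⟩

theorem Realization.continuous_val (Q : PreAbstractSimplicialComplex V) :
    Continuous (fun x : Realization Q => x.1) :=
  Realization.continuous_of_forall fun _ => continuous_subtype_val

/-- A map into a finite subcomplex is continuous if its barycentric coordinates are. -/
theorem Realization.continuous_of_coordinates {X : Type*} [TopologicalSpace X]
    {Q : PreAbstractSimplicialComplex V} {f : X → Realization Q} {S : Finset V}
    (hS : ∀ x, ∀ v, v ∉ S → (f x).1 v = 0) (hf : Continuous fun x => (f x).1) :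
    Continuous f := by
  let ι := {s : Finset V // s ∈ Q.faces ∧ s ⊆ S}
  have : Finite ι := Finite.of_injective
    (fun s : ι => (⟨s.1, Finset.mem_powerset.2 s.2.2⟩ : S.powerset))
    fun a b h => Subtype.ext (by simpa using h)
  -- The finitely many faces within S give a finite closed cover of the source, and on each closed
  -- simplex the weak topology is the coordinate topology.
  refine LocallyFinite.continuous
    (locallyFinite_of_finite fun s : ι => {x | (f x).1 ∈ closedSimplex s.1}) ?_ ?_ ?_
  · refine Set.eq_univ_of_forall fun x => Set.mem_iUnion.2 ?_
    obtain ⟨s, hs, hsS, hx⟩ := InComplex.exists_face_subset (f x).2 (hS x)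
    exact ⟨⟨s, hs, hsS⟩, hx⟩
  · exact fun s => (isClosed_closedSimplex s.1).preimage hf
  · intro s
    rw [continuousOn_iff_continuous_domRestrict]
    exact (continuous_ofSimplex Q ⟨s.1, s.2.1⟩).comp
      (Continuous.subtype_mk (hf.comp continuous_subtype_val) fun x => x.2)

/-! ### Homotopies with finite support -/

variable {X : Type*} [TopologicalSpace X]

/-- `f` takes values in the subcomplex of `Q` spanned by the finite set `S`. -/
def Supported (Q : PreAbstractSimplicialComplex V) (S : Finset V) (f : C(X, V → ℝ)) : Prop :=
  ∀ x, InComplex Q (f x) ∧ ∀ v, v ∉ S → f x v = 0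

theorem Supported.mono {Q : PreAbstractSimplicialComplex V} {S T : Finset V} (h : S ⊆ T)
    {f : C(X, V → ℝ)} (hf : Supported Q S f) : Supported Q T f :=
  fun x => ⟨(hf x).1, fun v hv => (hf x).2 v fun hS => hv (h hS)⟩

theorem homotopicWith_mono {Q : PreAbstractSimplicialComplex V} {S T : Finset V} (h : S ⊆ T)
    {f g : C(X, V → ℝ)} (hfg : f.HomotopicWith g (Supported Q S)) :
    f.HomotopicWith g (Supported Q T) :=
  hfg.map fun F => { F with prop' := fun t => (F.prop' t).mono h }

open Classical in
/-- The composition of `f` with the affine extension of the map `φ` of vertices. -/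
noncomputable def pushforward (S : Finset V) (φ : V → V) (f : C(X, V → ℝ)) : C(X, V → ℝ) where
  toFun x w := ∑ v ∈ S with φ v = w, f x v
  continuous_toFun := continuous_pi fun _ => continuous_finsetSum _ fun v _ =>
    (continuous_apply v).comp f.continuous

open Classical in
theorem pushforward_mem_closedSimplex {S s : Finset V} (φ : V → V) {f : C(X, V → ℝ)} {x : X}
    (hsS : s ⊆ S) (hs : f x ∈ closedSimplex s) :
    pushforward S φ f x ∈ closedSimplex (s.image φ) := by
  have hS := closedSimplex_mono hsS hs
  have h : pushforward S φ f x ∈ closedSimplex (S.image φ) := by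
    refine ⟨fun w => Finset.sum_nonneg fun v _ => hs.1 v, fun w hw => Finset.sum_eq_zero ?_, ?_⟩
    · intro v hv
      rw [Finset.mem_filter] at hv
      exact absurd (Finset.mem_image.2 ⟨v, hv⟩) hw
    · exact (Finset.sum_fiberwise_of_maps_to
        (fun v hv => Finset.mem_image_of_mem φ hv) _).trans hS.2.2
  refine closedSimplex_of_vanish h fun w hw => Finset.sum_eq_zero fun v hv => ?_
  rw [Finset.mem_filter] at hv
  exact hs.2.1 v fun hvs => hw (Finset.mem_image.2 ⟨v, hvs, hv.2⟩)

open Classical in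
theorem supported_pushforward {Q : PreAbstractSimplicialComplex V} {S : Finset V} {φ : V → V}
    (hφ : ∀ s ∈ Q.faces, s ⊆ S → s ∪ s.image φ ∈ Q.faces) {f : C(X, V → ℝ)}
    (hf : Supported Q S f) : Supported Q (S.image φ) (pushforward S φ f) := by
  intro x
  obtain ⟨s, hs, hsS, hxs⟩ := (hf x).1.exists_face_subset (hf x).2
  have h := pushforward_mem_closedSimplex φ hsS hxs
  exact ⟨⟨_, hφ s hs hsS, closedSimplex_mono Finset.subset_union_right h⟩,
    (closedSimplex_mono (Finset.image_subset_image hsS) h).2.1⟩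

open Classical in
/-- Contiguous maps are homotopic. -/
theorem homotopicWith_pushforward {Q : PreAbstractSimplicialComplex V} {S : Finset V} {φ : V → V}
    (hφ : ∀ s ∈ Q.faces, s ⊆ S → s ∪ s.image φ ∈ Q.faces) {f : C(X, V → ℝ)}
    (hf : Supported Q S f) :
    f.HomotopicWith (pushforward S φ f) (Supported Q (S ∪ S.image φ)) := by
  -- Straight-line homotopy: both endpoints lie in the simplex spanned by s ∪ φ(s).
  refine ⟨⟨⟨⟨fun p => (1 - (p.1 : ℝ)) • f p.2 + (p.1 : ℝ) • pushforward S φ f p.2, ?_⟩,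
    ?_, ?_⟩, ?_⟩⟩
  · fun_prop
  · intro x; simp
  · intro x; simp
  · intro t x
    obtain ⟨s, hs, hsS, hxs⟩ := (hf x).1.exists_face_subset (hf x).2
    have hmem : (1 - (t : ℝ)) • f x + (t : ℝ) • pushforward S φ f x ∈
        closedSimplex (s ∪ s.image φ) :=
      convex_closedSimplex _ (closedSimplex_mono Finset.subset_union_left hxs)
        (closedSimplex_mono Finset.subset_union_right (pushforward_mem_closedSimplex φ hsS hxs))
        (sub_nonneg.2 t.2.2) t.2.1 (by ring)
    exact ⟨⟨_, hφ s hs hsS, hmem⟩, (closedSimplex_mono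
      (Finset.union_subset_union hsS (Finset.image_subset_image hsS)) hmem).2.1⟩

open Classical in
/-- If finite sets of vertices can be moved to `x₀` by contiguous maps that decrease the total
size `m` of the vertices, then maps into finite subcomplexes are null-homotopic. -/
theorem exists_homotopicWith_const {Q : PreAbstractSimplicialComplex V} {x₀ : V}
    (m : V → ℕ) (W : Set V)
    (hmove : ∀ S : Finset V, (∀ v ∈ S, v ∈ W) → (∃ u ∈ S, u ≠ x₀) →
      ∃ φ : V → V, (∀ v ∈ S, φ v ∈ W) ∧ ∑ v ∈ S, m (φ v) < ∑ v ∈ S, m v ∧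
        ∀ s ∈ Q.faces, s ⊆ S → s ∪ s.image φ ∈ Q.faces)
    (S : Finset V) (hS : ∀ v ∈ S, v ∈ W) (f : C(X, V → ℝ)) (hf : Supported Q S f) :
    ∃ T : Finset V,
      f.HomotopicWith (ContinuousMap.const X (Pi.single x₀ 1)) (Supported Q T) := by
  induction hn : ∑ v ∈ S, m v using Nat.strong_induction_on generalizing S f with
  | _ n ih =>
    by_cases h : ∃ u ∈ S, u ≠ x₀
    · obtain ⟨φ, hφW, hφm, hφ⟩ := hmove S hS h
      have hle : ∑ v ∈ S.image φ, m v ≤ ∑ v ∈ S, m (φ v) :=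
        Finset.sum_image_le_of_nonneg fun _ _ => Nat.zero_le _
      obtain ⟨T, hT⟩ := ih _ (hn ▸ hle.trans_lt hφm) (S.image φ)
        (by simpa using hφW) (pushforward S φ f) (supported_pushforward hφ hf) rfl
      exact ⟨S ∪ S.image φ ∪ T, (homotopicWith_mono Finset.subset_union_left
        (homotopicWith_pushforward hφ hf)).trans (homotopicWith_mono Finset.subset_union_right hT)⟩
    · push Not at h
      have hfc : f = ContinuousMap.const X (Pi.single x₀ 1) := by
        ext1 x
        obtain ⟨s, hs, hsS, hxs⟩ := (hf x).1.exists_face_subset (hf x).2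
        exact eq_single_of_mem_closedSimplex
          (closedSimplex_mono (fun v hv => Finset.mem_singleton.2 (h v (hsS hv))) hxs)
      exact ⟨S, hfc ▸ ContinuousMap.HomotopicWith.refl f hf⟩

end Coordinates

/-! ### Contractibility from null-homotopies of maps with finite support -/

section Contractible

universe u

variable {V : Type u}

/-- The prism over a closed simplex. -/
def prism (s : Finset V) : Set ((V → ℝ) × ℝ) := closedSimplex s ×ˢ Set.Icc 0 1

/-- The boundary of the prism over a closed simplex. -/
def prismBoundary (s : Finset V) : Set ((V → ℝ) × ℝ) :=
  {p ∈ prism s | (∃ v ∈ s, p.1 v = 0) ∨ p.2 = 0 ∨ p.2 = 1}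

theorem isCompact_prism (s : Finset V) : IsCompact (prism s) :=
  (isCompact_closedSimplex s).prod isCompact_Icc

theorem convex_prism (s : Finset V) : Convex ℝ (prism s) :=
  (convex_closedSimplex s).prod (convex_Icc 0 1)

theorem isCompact_prismBoundary (s : Finset V) : IsCompact (prismBoundary s) := by
  have h : prismBoundary s = prism s ∩ ((⋃ v ∈ s, {p : (V → ℝ) × ℝ | p.1 v = 0}) ∪
      ({p | p.2 = 0} ∪ {p | p.2 = 1})) := by
    ext p
    simp only [prismBoundary, Set.mem_ofPred_eq, Set.mem_inter_iff, Set.mem_union, Set.mem_iUnion,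
      exists_prop]
  rw [h]
  refine (isCompact_prism s).inter_right (IsClosed.union (s.finite_toSet.isClosed_biUnion ?_)
    (IsClosed.union ?_ ?_))
  · exact fun v _ => isClosed_eq ((continuous_apply v).comp continuous_fst) continuous_const
  · exact isClosed_eq continuous_snd continuous_const
  · exact isClosed_eq continuous_snd continuous_const

open Classical in
/-- The center of the prism. -/
noncomputable def prismCenter (s : Finset V) : (V → ℝ) × ℝ :=
  (fun v => if v ∈ s then (s.card : ℝ)⁻¹ else 0, 1 / 2)

theorem prismCenter_mem {s : Finset V} (hs : s.Nonempty) : prismCenter s ∈ prism s := by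
  have hc : (0 : ℝ) < s.card := by exact_mod_cast hs.card_pos
  refine ⟨⟨fun v => ?_, fun v hv => by simp [prismCenter, hv], ?_⟩, by norm_num [prismCenter]⟩
  · simp only [prismCenter]
    split_ifs <;> positivity
  · simp only [prismCenter]
    rw [Finset.sum_congr rfl fun v hv => if_pos hv]
    simp [hs.ne_empty]

/-- Points on the open segment between the center and a point of the prism are not on the
boundary. -/
theorem notMem_prismBoundary {s : Finset V} (hs : s.Nonempty) {q : (V → ℝ) × ℝ}
    (hq : q ∈ prism s) {a b : ℝ} (ha : 0 ≤ a) (hb : 0 < b) (hab : a + b = 1) :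
    a • q + b • prismCenter s ∉ prismBoundary s := by
  have hc : (0 : ℝ) < s.card := by exact_mod_cast hs.card_pos
  obtain ⟨hq1, hq0, hq2⟩ := hq
  rintro ⟨-, ⟨v, hv, h⟩ | h | h⟩
  · simp only [prismCenter, Prod.fst_add, Prod.smul_fst, Pi.add_apply, Pi.smul_apply, smul_eq_mul,
      if_pos hv] at h
    have h1 := mul_nonneg ha (hq1.1 v)
    have h2 : 0 < b * (s.card : ℝ)⁻¹ := by positivity
    linarith
  · simp only [prismCenter, Prod.snd_add, Prod.smul_snd, smul_eq_mul] at h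
    have h1 := mul_nonneg ha hq0
    linarith
  · simp only [prismCenter, Prod.snd_add, Prod.smul_snd, smul_eq_mul] at h
    have h1 := mul_le_mul_of_nonneg_left hq2 ha
    linarith

/-- If t < t', solving for q puts it on the segment from q' to the center, away from q', where no
boundary points lie. -/
theorem prism_cone_injective {s : Finset V} (hs : s.Nonempty) {q q' : (V → ℝ) × ℝ}
    (hq : q ∈ prismBoundary s) (hq' : q' ∈ prismBoundary s) {t t' : ℝ} (ht' : t' ≤ 1)
    (htt' : t ≤ t')
    (h : (1 - t) • q + t • prismCenter s = (1 - t') • q' + t' • prismCenter s) :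
    t = t' ∧ (t = 1 ∨ q = q') := by
  rcases htt'.eq_or_lt with rfl | hlt
  · refine ⟨rfl, ?_⟩
    by_cases h1 : t = 1
    · exact Or.inl h1
    · exact Or.inr (smul_right_injective _ (sub_ne_zero.2 (Ne.symm h1)) (add_right_cancel h))
  · exfalso
    have h1 : 0 < 1 - t := by linarith
    have hq2 : q = ((1 - t') / (1 - t)) • q' + ((t' - t) / (1 - t)) • prismCenter s := by
      have h2 : (1 - t) • q = (1 - t') • q' + (t' - t) • prismCenter s := by
        rw [sub_smul t' t, ← add_sub_assoc, ← h, add_sub_cancel_right]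
      rw [← inv_smul_smul₀ h1.ne' q, h2, smul_add, smul_smul, smul_smul, div_eq_inv_mul,
        div_eq_inv_mul]
    refine notMem_prismBoundary hs hq'.1 (div_nonneg (by linarith) h1.le)
      (div_pos (by linarith) h1) ?_ (hq2 ▸ hq)
    field_simp
    ring

theorem prism_cone_surjective {s : Finset V} (hs : s.Nonempty) {p : (V → ℝ) × ℝ}
    (hp : p ∈ prism s) :
    ∃ q ∈ prismBoundary s, ∃ t ∈ Set.Icc (0 : ℝ) 1, (1 - t) • q + t • prismCenter s = p := by
  have hc : (0 : ℝ) < s.card := by exact_mod_cast hs.card_pos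
  obtain ⟨hp1, hp0, hp2⟩ := hp
  obtain ⟨v₀, hv₀, hmin⟩ := s.exists_min_image p.1 hs
  have hcmin : s.card * p.1 v₀ ≤ 1 := by
    rw [← hp1.2.2, ← nsmul_eq_mul]
    exact Finset.card_nsmul_le_sum _ _ _ hmin
  -- The largest multiple of the center that can be split off from p within the prism. The
  -- constraint attaining the minimum becomes an equality, placing the rest on the boundary; t = 1
  -- means that p is the center.
  set t : ℝ := min (s.card * p.1 v₀) (min (2 * p.2) (2 * (1 - p.2))) with ht
  have ht0 : 0 ≤ t := le_min (mul_nonneg hc.le (hp1.1 v₀)) (le_min (by linarith) (by linarith))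
  have htv : t ≤ s.card * p.1 v₀ := min_le_left _ _
  have hta : t ≤ 2 * p.2 := (min_le_right _ _).trans (min_le_left _ _)
  have htb : t ≤ 2 * (1 - p.2) := (min_le_right _ _).trans (min_le_right _ _)
  have ht1 : t ≤ 1 := htv.trans hcmin
  have htv' : ∀ v ∈ s, t * (s.card : ℝ)⁻¹ ≤ p.1 v := fun v hv => by
    rw [← div_eq_mul_inv, div_le_iff₀ hc, mul_comm]
    exact htv.trans (mul_le_mul_of_nonneg_left (hmin v hv) hc.le)
  rcases ht1.eq_or_lt with h1 | h1
  · refine ⟨(p.1, 0), ⟨⟨hp1, by simp⟩, Or.inr (Or.inl rfl)⟩, 1, by simp, ?_⟩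
    simp only [sub_self, zero_smul, one_smul, zero_add]
    rw [h1] at htv' hta htb
    refine Prod.ext (funext fun v => ?_) ?_
    · by_cases hv : v ∈ s
      · simp only [prismCenter, if_pos hv]
        have hsum : ∑ w ∈ s, (s.card : ℝ)⁻¹ = ∑ w ∈ s, p.1 w := by
          rw [hp1.2.2]
          simp [hc.ne']
        exact (Finset.sum_eq_sum_iff_of_le fun w hw => by simpa using htv' w hw).1 hsum v hv
      · simp [prismCenter, hv, hp1.2.1 v hv]
    · simp only [prismCenter]
      linarith
  · have h1' : 0 < 1 - t := by linarith
    have hcm := prismCenter_mem hs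
    refine ⟨(1 - t)⁻¹ • (p - t • prismCenter s), ⟨⟨⟨fun v => ?_, fun v hv => ?_, ?_⟩, ?_, ?_⟩, ?_⟩,
      t, ⟨ht0, ht1⟩, ?_⟩
    · refine mul_nonneg (inv_nonneg.2 h1'.le) ?_
      by_cases hv : v ∈ s
      · simpa [prismCenter, hv] using htv' v hv
      · simp [prismCenter, hv, hp1.2.1 v hv]
    · simp [prismCenter, hv, hp1.2.1 v hv]
    · have := hcm.1.2.2
      simp [← Finset.mul_sum, hp1.2.2, this, h1'.ne']
    · refine mul_nonneg (inv_nonneg.2 h1'.le) ?_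
      simp only [prismCenter, Prod.snd_sub, Prod.smul_snd, smul_eq_mul]
      linarith
    · simp only [prismCenter, Prod.smul_snd, Prod.snd_sub, smul_eq_mul]
      rw [inv_mul_le_iff₀ h1']
      linarith
    · rcases min_choice (s.card * p.1 v₀) (min (2 * p.2) (2 * (1 - p.2))) with h | h
      · refine Or.inl ⟨v₀, hv₀, ?_⟩
        simp only [prismCenter, Prod.smul_fst, Prod.fst_sub, Pi.smul_apply, Pi.sub_apply,
          if_pos hv₀, smul_eq_mul]
        rw [ht, h]
        field_simp
        simp
      · rcases min_choice (2 * p.2) (2 * (1 - p.2)) with h' | h'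
        · refine Or.inr (Or.inl ?_)
          have : t = 2 * p.2 := by rw [ht, h, h']
          simp only [prismCenter, Prod.smul_snd, Prod.snd_sub, smul_eq_mul]
          rw [show p.2 - t * (1 / 2) = 0 by linarith, mul_zero]
        · refine Or.inr (Or.inr ?_)
          have : t = 2 * (1 - p.2) := by rw [ht, h, h']
          simp only [prismCenter, Prod.smul_snd, Prod.snd_sub, smul_eq_mul]
          rw [show p.2 - t * (1 / 2) = 1 - t by linarith, inv_mul_cancel₀ h1'.ne']
    · rw [smul_inv_smul₀ h1'.ne', sub_add_cancel]

/-- `h` maps `A` continuously into a finite subcomplex of `Q`. -/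
def FinitelySupportedOn (Q : PreAbstractSimplicialComplex V) (h : (V → ℝ) × ℝ → V → ℝ)
    (A : Set ((V → ℝ) × ℝ)) : Prop :=
  ContinuousOn h A ∧ ∃ S : Finset V, ∀ p ∈ A, InComplex Q (h p) ∧ ∀ v, v ∉ S → h p v = 0

theorem FinitelySupportedOn.congr {Q : PreAbstractSimplicialComplex V}
    {h h' : (V → ℝ) × ℝ → V → ℝ} {A : Set ((V → ℝ) × ℝ)} (hh : FinitelySupportedOn Q h A)
    (heq : Set.EqOn h' h A) : FinitelySupportedOn Q h' A := by
  obtain ⟨hc, S, hS⟩ := hh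
  exact ⟨hc.congr heq, S, fun p hp => by rw [heq hp]; exact hS p hp⟩

open Classical in
/-- Maps into finite subcomplexes of `Q` are null-homotopic within finite subcomplexes. -/
def FinitelyNullhomotopic (Q : PreAbstractSimplicialComplex V) (x₀ : V) : Prop :=
  ∀ (X : Type u) [TopologicalSpace X] (S : Finset V) (f : C(X, V → ℝ)), Supported Q S f →
    ∃ T : Finset V,
      f.HomotopicWith (ContinuousMap.const X (Pi.single x₀ 1)) (Supported Q T)

/-- The null-homotopy F of the boundary map is constant at time 1, so it factors through the cone
over the boundary, which is the prism. The cone map κ is a quotient map since its source is compact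
and its target Hausdorff. -/
theorem exists_extension {Q : PreAbstractSimplicialComplex V} {x₀ : V}
    (hQ : FinitelyNullhomotopic Q x₀) {s : Finset V} (hs : s.Nonempty)
    {g : (V → ℝ) × ℝ → V → ℝ} (hg : FinitelySupportedOn Q g (prismBoundary s)) :
    ∃ g', Set.EqOn g' g (prismBoundary s) ∧ FinitelySupportedOn Q g' (prism s) := by
  classical
  obtain ⟨hgc, S, hS⟩ := hg
  let f : C(prismBoundary s, V → ℝ) := ⟨(prismBoundary s).domRestrict g, hgc.domRestrict⟩
  obtain ⟨T, ⟨F⟩⟩ := hQ (prismBoundary s) S f fun x => hS x.1 x.2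
  let κ : unitInterval × prismBoundary s → prism s := fun z =>
    ⟨(1 - (z.1 : ℝ)) • z.2.1 + (z.1 : ℝ) • prismCenter s,
      convex_prism s z.2.2.1 (prismCenter_mem hs) (sub_nonneg.2 z.1.2.2) z.1.2.1 (by ring)⟩
  have hκc : Continuous κ := by
    refine Continuous.subtype_mk ?_ _
    fun_prop
  have hκs : Function.Surjective κ := by
    rintro ⟨p, hp⟩
    obtain ⟨q, hq, t, ht, h⟩ := prism_cone_surjective hs hp
    exact ⟨(⟨t, ht⟩, ⟨q, hq⟩), Subtype.ext h⟩
  have : CompactSpace (prismBoundary s) := isCompact_iff_compactSpace.1 (isCompact_prismBoundary s)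
  have hκq : Topology.IsQuotientMap κ := hκc.isClosedMap.isQuotientMap hκc hκs
  have hF1 : ∀ q q', F (1, q) = F (1, q') := fun q q' => by simp
  have hκF : ∀ z z', κ z = κ z' → F z = F z' := by
    have key : ∀ z z', z.1 ≤ z'.1 → κ z = κ z' → F z = F z' := by
      rintro ⟨t, q⟩ ⟨t', q'⟩ hle h
      obtain ⟨h1, h2⟩ := prism_cone_injective hs q.2 q'.2 t'.2.2 hle (congrArg Subtype.val h)
      obtain rfl : t = t' := Subtype.ext h1
      rcases h2 with h2 | h2
      · obtain rfl : t = 1 := Subtype.ext h2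
        exact hF1 q q'
      · rw [Subtype.ext h2]
    intro z z' h
    rcases le_total z.1 z'.1 with hle | hle
    · exact key z z' hle h
    · exact (key z' z hle h.symm).symm
  let G : prism s → V → ℝ := fun p => F (Function.surjInv hκs p)
  have hGκ : ∀ z, G (κ z) = F z := fun z => hκF _ _ (Function.surjInv_eq hκs (κ z))
  have hGc : Continuous G := by
    rw [hκq.continuous_iff]
    exact F.continuous.congr fun z => (hGκ z).symm
  refine ⟨fun p => if hp : p ∈ prism s then G ⟨p, hp⟩ else 0, fun p hp => ?_, ?_, T, fun p hp => ?_⟩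
  · have h0 : κ (0, ⟨p, hp⟩) = ⟨p, hp.1⟩ := Subtype.ext (by simp [κ])
    simp only [dif_pos hp.1]
    rw [← h0, hGκ]
    exact F.apply_zero _
  · rw [continuousOn_iff_continuous_domRestrict]
    refine hGc.congr fun p => ?_
    simp
  · simp only [dif_pos hp]
    exact F.prop' (Function.surjInv hκs ⟨p, hp⟩).1 (Function.surjInv hκs ⟨p, hp⟩).2

open Classical in
/-- `h` is a contraction of the simplices of `Q` with at most `n` vertices. -/
structure IsSkeletonContraction (Q : PreAbstractSimplicialComplex V) (x₀ : V) (n : ℕ)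
    (h : (V → ℝ) × ℝ → V → ℝ) : Prop where
  zero : ∀ x, h (x, 0) = x
  one : ∀ x, h (x, 1) = Pi.single x₀ 1
  face : ∀ s ∈ Q.faces, s.card ≤ n → FinitelySupportedOn Q h (prism s)

theorem IsSkeletonContraction.boundary {Q : PreAbstractSimplicialComplex V} {x₀ : V}
    (hx₀ : {x₀} ∈ Q.faces) {n : ℕ} {h : (V → ℝ) × ℝ → V → ℝ}
    (hh : IsSkeletonContraction Q x₀ n h) {s : Finset V} (hs : s ∈ Q.faces)
    (hsn : s.card = n + 1) : FinitelySupportedOn Q h (prismBoundary s) := by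
  classical
  have hface : ∀ v ∈ s, FinitelySupportedOn Q h {p ∈ prism s | p.1 v = 0} := by
    intro v hv
    have hsub : {p ∈ prism s | p.1 v = 0} ⊆ prism (s.erase v) := by
      rintro p ⟨⟨hp1, hp2⟩, hpv⟩
      refine ⟨closedSimplex_of_vanish hp1 fun w hw => ?_, hp2⟩
      rcases eq_or_ne w v with rfl | hwv
      · exact hpv
      · exact hp1.2.1 w fun hws => hw (Finset.mem_erase.2 ⟨hwv, hws⟩)
    -- A single vertex has no proper faces, so its boundary prism consists of top and bottom only.
    rcases (s.erase v).eq_empty_or_nonempty with he | hne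
    · have hemp : {p ∈ prism s | p.1 v = 0} = ∅ := by
        refine Set.eq_empty_of_forall_notMem fun p hp => ?_
        exact (nonempty_of_mem_closedSimplex (hsub hp).1).ne_empty he
      rw [hemp]
      exact ⟨continuousOn_empty _, ∅, by simp⟩
    · have hmem := face_of_subset hs (Finset.erase_subset v s) hne
      obtain ⟨hc, S, hS⟩ := hh.face _ hmem (by rw [Finset.card_erase_of_mem hv]; omega)
      exact ⟨hc.mono hsub, S, fun p hp => hS p (hsub hp)⟩
  choose! hfc Sf hSf using hface
  have h0 : ContinuousOn h {p ∈ prism s | p.2 = 0} :=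
    continuous_fst.continuousOn.congr fun p hp => by
      obtain ⟨x, t⟩ := p
      obtain rfl : t = 0 := hp.2
      exact hh.zero x
  have h1 : ContinuousOn h {p ∈ prism s | p.2 = 1} :=
    (continuous_const (y := (Pi.single x₀ 1 : V → ℝ))).continuousOn.congr fun p hp => by
      obtain ⟨x, t⟩ := p
      obtain rfl : t = 1 := hp.2
      exact hh.one x
  have hclosed : IsClosed (prism s) := (isCompact_prism s).isClosed
  refine ⟨?_, s.biUnion Sf ∪ s ∪ {x₀}, ?_⟩
  · have heq : prismBoundary s = (⋃ v : s, {p ∈ prism s | p.1 v = 0}) ∪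
        ({p ∈ prism s | p.2 = 0} ∪ {p ∈ prism s | p.2 = 1}) := by
      ext p
      simp only [prismBoundary, Set.mem_ofPred_eq, Set.mem_union, Set.mem_iUnion, Subtype.exists]
      constructor
      · rintro ⟨hp, ⟨v, hv, h⟩ | h | h⟩
        · exact Or.inl ⟨v, hv, hp, h⟩
        · exact Or.inr (Or.inl ⟨hp, h⟩)
        · exact Or.inr (Or.inr ⟨hp, h⟩)
      · rintro (⟨v, hv, hp, h⟩ | ⟨hp, h⟩ | ⟨hp, h⟩)
        · exact ⟨hp, Or.inl ⟨v, hv, h⟩⟩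
        · exact ⟨hp, Or.inr (Or.inl h)⟩
        · exact ⟨hp, Or.inr (Or.inr h)⟩
    have hcl : ∀ v : V, IsClosed {p ∈ prism s | p.1 v = 0} := fun v =>
      hclosed.inter (isClosed_eq ((continuous_apply v).comp continuous_fst) continuous_const)
    have hc0 : IsClosed {p ∈ prism s | p.2 = 0} :=
      hclosed.inter (isClosed_eq continuous_snd continuous_const)
    have hc1 : IsClosed {p ∈ prism s | p.2 = 1} :=
      hclosed.inter (isClosed_eq continuous_snd continuous_const)
    rw [heq]
    refine ContinuousOn.union_of_isClosed ?_ (h0.union_of_isClosed h1 hc0 hc1)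
      (isClosed_iUnion_of_finite fun v => hcl v) (hc0.union hc1)
    exact (locallyFinite_of_finite _).continuousOn_iUnion (fun v => hcl v) fun v => hfc v v.2
  · rintro ⟨x, t⟩ ⟨hp, ⟨v, hv, h⟩ | h | h⟩
    · obtain ⟨h2, h3⟩ := hSf v hv _ ⟨hp, h⟩
      refine ⟨h2, fun w hw => h3 w fun hw' => hw ?_⟩
      simp only [Finset.mem_union, Finset.mem_biUnion]
      exact Or.inl (Or.inl ⟨v, hv, hw'⟩)
    · obtain rfl : t = 0 := h
      rw [hh.zero]
      refine ⟨⟨s, hs, hp.1⟩, fun w hw => hp.1.2.1 w fun hw' => hw ?_⟩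
      simp [hw']
    · obtain rfl : t = 1 := h
      rw [hh.one]
      refine ⟨⟨_, hx₀, single_mem_closedSimplex x₀⟩, fun w hw => ?_⟩
      exact (single_mem_closedSimplex x₀).2.1 w fun hw' => hw (Finset.mem_union_right _ hw')

theorem IsSkeletonContraction.exists_succ {Q : PreAbstractSimplicialComplex V} {x₀ : V}
    (hx₀ : {x₀} ∈ Q.faces) (hQ : FinitelyNullhomotopic Q x₀) {n : ℕ}
    {h : (V → ℝ) × ℝ → V → ℝ} (hh : IsSkeletonContraction Q x₀ n h) :
    ∃ h', IsSkeletonContraction Q x₀ (n + 1) h' ∧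
      ∀ s ∈ Q.faces, s.card ≤ n → ∀ x ∈ closedSimplex s, ∀ t, h' (x, t) = h (x, t) := by
  classical
  have hext : ∀ s : Finset V, s ∈ Q.faces ∧ s.card = n + 1 →
      ∃ g, Set.EqOn g h (prismBoundary s) ∧ FinitelySupportedOn Q g (prism s) :=
    fun s hs => exists_extension hQ (face_nonempty hs.1) (hh.boundary hx₀ hs.1 hs.2)
  choose! g hgb hg using hext
  -- The interior of the prism over an (n+1)-vertex face. On such a prism only its own interior is
  -- redefined, since s is contained in every face carrying the point.
  let Open (s : Finset V) (p : (V → ℝ) × ℝ) : Prop :=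
    (s ∈ Q.faces ∧ s.card = n + 1) ∧ p.1 ∈ closedSimplex s ∧ (∀ v ∈ s, p.1 v ≠ 0) ∧
      p.2 ≠ 0 ∧ p.2 ≠ 1
  have hsubset : ∀ {s t : Finset V} {p}, Open s p → p.1 ∈ closedSimplex t → s ⊆ t :=
    fun {s t p} hs ht v hv => by
      by_contra hvt
      exact hs.2.2.1 v hv (ht.2.1 v hvt)
  let h' : (V → ℝ) × ℝ → V → ℝ := fun p =>
    if hp : ∃ s, Open s p then g hp.choose p else h p
  have hlow : ∀ s ∈ Q.faces, s.card ≤ n → ∀ x ∈ closedSimplex s, ∀ t, h' (x, t) = h (x, t) := by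
    intro s hs hsn x hx t
    refine dif_neg ?_
    rintro ⟨s', hs'⟩
    have h1 := Finset.card_le_card (hsubset hs' hx)
    have h2 := hs'.1.2
    omega
  refine ⟨h', ⟨fun x => ?_, fun x => ?_, fun s hs hsn => ?_⟩, hlow⟩
  · refine (dif_neg ?_).trans (hh.zero x)
    rintro ⟨s', hs'⟩
    exact hs'.2.2.2.1 rfl
  · refine (dif_neg ?_).trans (hh.one x)
    rintro ⟨s', hs'⟩
    exact hs'.2.2.2.2 rfl
  · rcases Nat.lt_succ_iff_lt_or_eq.1 (Nat.lt_succ_of_le hsn) with hlt | heq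
    · exact (hh.face s hs (by omega)).congr fun p hp => hlow s hs (by omega) p.1 hp.1 p.2
    · refine (hg s ⟨hs, heq⟩).congr fun p hp => ?_
      by_cases hp' : ∃ s', Open s' p
      · have hs' := hp'.choose_spec
        have hss' : hp'.choose = s := Finset.eq_of_subset_of_card_le (hsubset hs' hp.1)
          (by rw [hs'.1.2, heq])
        simp only [h', dif_pos hp', hss']
      · simp only [h', dif_neg hp']
        refine (hgb s ⟨hs, heq⟩ ⟨hp, ?_⟩).symm
        by_contra hb
        push Not at hb
        exact hp' ⟨s, ⟨hs, heq⟩, hp.1, hb⟩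

theorem exists_contraction {Q : PreAbstractSimplicialComplex V} {x₀ : V}
    (hx₀ : {x₀} ∈ Q.faces) (hQ : FinitelyNullhomotopic Q x₀) :
    ∃ h : (V → ℝ) × ℝ → V → ℝ, ∀ n, IsSkeletonContraction Q x₀ n h := by
  classical
  -- There are no faces with 0 vertices, so only the values at times 0 and 1 are constrained.
  have hbase : IsSkeletonContraction Q x₀ 0
      (fun p => if p.2 = 1 then Pi.single x₀ 1 else p.1) := by
    refine ⟨fun x => by simp, fun x => by simp, fun s hs hs0 => ?_⟩
    have := (face_nonempty hs).card_pos
    omega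
  choose! step hstep using fun (n : ℕ) (h : (V → ℝ) × ℝ → V → ℝ)
    (hh : IsSkeletonContraction Q x₀ n h) => hh.exists_succ hx₀ hQ
  let H : ℕ → (V → ℝ) × ℝ → V → ℝ := fun n =>
    Nat.rec (fun p => if p.2 = 1 then Pi.single x₀ 1 else p.1) step n
  have hH : ∀ n, IsSkeletonContraction Q x₀ n (H n) := by
    intro n
    induction n with
    | zero => exact hbase
    | succ n ih => exact (hstep n _ ih).1
  have hstable : ∀ s ∈ Q.faces, ∀ n m, s.card ≤ n → n ≤ m → ∀ x ∈ closedSimplex s, ∀ t,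
      H m (x, t) = H n (x, t) := by
    intro s hs n m hsn hnm x hx t
    induction m, hnm using Nat.le_induction with
    | base => rfl
    | succ m hm ih => rw [← ih]; exact (hstep m _ (hH m)).2 s hs (hsn.trans hm) x hx t
  -- The stage from which the values over x no longer change; on a fixed face s the limit agrees
  -- with stage `s.card`.
  let N : (V → ℝ) → ℕ := fun x => sInf {n | ∃ s ∈ Q.faces, s.card = n ∧ x ∈ closedSimplex s}
  have hN : ∀ s ∈ Q.faces, ∀ x ∈ closedSimplex s, ∀ t, H (N x) (x, t) = H s.card (x, t) := by
    intro s hs x hx t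
    have hmem : s.card ∈ {n | ∃ s ∈ Q.faces, s.card = n ∧ x ∈ closedSimplex s} :=
      ⟨s, hs, rfl, hx⟩
    obtain ⟨s', hs', hc', hx'⟩ := Nat.sInf_mem ⟨_, hmem⟩
    exact (hstable s' hs' (N x) s.card hc'.le (Nat.sInf_le hmem) x hx' t).symm
  refine ⟨fun p => H (N p.1) p, fun n => ⟨fun x => (hH _).zero x, fun x => (hH _).one x,
    fun s hs _ => ?_⟩⟩
  exact ((hH s.card).face s hs le_rfl).congr fun p hp => hN s hs p.1 hp.1 p.2

theorem contractibleSpace_of_finitelyNullhomotopic {Q : PreAbstractSimplicialComplex V} {x₀ : V}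
    (hx₀ : {x₀} ∈ Q.faces) (hQ : FinitelyNullhomotopic Q x₀) :
    ContractibleSpace (Realization Q) := by
  classical
  obtain ⟨h, hh⟩ := exists_contraction hx₀ hQ
  have hface : ∀ s ∈ Q.faces, FinitelySupportedOn Q h (prism s) :=
    fun s hs => (hh s.card).face s hs le_rfl
  have hmem : ∀ (x : Realization Q) (t : unitInterval), InComplex Q (h (x.1, t)) := by
    intro x t
    obtain ⟨s, hs, hx⟩ := x.2
    obtain ⟨-, S, hS⟩ := hface s hs
    exact (hS _ ⟨hx, t.2⟩).1
  let H : Realization Q → unitInterval → Realization Q := fun x t => ⟨h (x.1, t), hmem x t⟩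
  have hHs : ∀ s : Q.faces, Continuous
      (Function.uncurry fun (x : closedSimplex s.1) t => H (Realization.ofSimplex Q s x) t) := by
    intro s
    obtain ⟨hc, S, hS⟩ := hface s.1 s.2
    refine Realization.continuous_of_coordinates (S := S) (fun z => (hS _ ⟨z.1.2, z.2.2⟩).2) ?_
    exact hc.comp_continuous (f := fun z : closedSimplex s.1 × unitInterval => (z.1.1, (z.2 : ℝ)))
      (by fun_prop) fun z => ⟨z.1.2, z.2.2⟩
  have hHt : ∀ x, Continuous (H x) := by
    intro x
    obtain ⟨s, hs, hx⟩ := x.2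
    exact (hHs ⟨s, hs⟩).comp (Continuous.prodMk_right ⟨x.1, hx⟩)
  -- The weak topology tests continuity only on the realization itself, not on its product with the
  -- interval. Currying reduces to the former, and local compactness of the interval allows
  -- uncurrying.
  let C : C(Realization Q, C(unitInterval, Realization Q)) :=
    ⟨fun x => ⟨H x, hHt x⟩, Realization.continuous_of_forall fun s =>
      ContinuousMap.continuous_of_continuous_uncurry _ (hHs s)⟩
  have hC := ContinuousMap.continuous_uncurry_of_continuous C
  rw [contractible_iff_id_nullhomotopic]
  refine ⟨⟨Pi.single x₀ 1, _, hx₀, single_mem_closedSimplex x₀⟩,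
    ⟨⟨⟨fun p => H p.2 p.1, hC.comp continuous_swap⟩, fun x => ?_, fun x => ?_⟩⟩⟩
  · exact Subtype.ext ((hh 0).zero x.1)
  · exact Subtype.ext ((hh 0).one x.1)

end Contractible

end RelRips

namespace RelRips

/-! ### The relative Rips complex -/

section RelativeRips

variable {V : Type*} {Γ : SimpleGraph V}

theorem Between.exists_geodesic (hconn : Γ.Connected) {a y b : V} (h : Between Γ a y b) :
    ∃ c : Geodesic Γ, c.Joins (Sum.inl a) (Sum.inl b) ∧ y ∈ c.support := by
  obtain ⟨p, hp⟩ := hconn.exists_walk_length_eq_dist a y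
  obtain ⟨q, hq⟩ := hconn.exists_walk_length_eq_dist y b
  have hl : (p.append q).length = Γ.dist a b := by
    rw [SimpleGraph.Walk.length_append, hp, hq, h]
  refine ⟨Geodesic.ofWalk hconn _ hl, Or.inl ⟨Geodesic.ofWalk_hasSource hconn _ hl,
    Geodesic.ofWalk_hasTarget hconn _ hl⟩, p.length, ?_, ?_⟩
  · simp [Geodesic.ofWalk]
  · simp [Geodesic.ofWalk, SimpleGraph.Walk.getVert_append]

theorem smallJoined_self (hconn : Γ.Connected) {d : ℝ} (hd : 0 ≤ d) (Θ : Set (Sym2 (Sym2 V)))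
    (v : V) : SmallJoined Γ d Θ v v := by
  refine smallJoined_of_forall_toward hconn (by simpa using hd) fun y p q hy hp _ => ?_
  have h1 := hp.dist_pos
  unfold Between at hy
  rw [SimpleGraph.dist_self] at hy
  omega

theorem singleton_mem_relativeRips (hconn : Γ.Connected) {d : ℝ} (hd : 0 ≤ d)
    (Θ : Set (Sym2 (Sym2 V))) (v : V) : {v} ∈ (relativeRips Γ d Θ).faces := by
  refine ⟨by simp, fun a ha b hb => ?_⟩
  rw [Finset.mem_singleton] at ha hb
  rw [ha, hb]
  exact smallJoined_self hconn hd Θ v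

open Classical in
/-- Within a set `W` of vertices containing all geodesics from points of `W` to `x₀`, finite sets
of vertices can be moved towards `x₀`. -/
theorem exists_contiguous_move (hconn : Γ.Connected) {δ : ℕ} (hδpos : 0 < δ)
    (hδ : IsHyperbolicityConstant Γ δ) {Θ : Set (Sym2 (Sym2 V))}
    (hΘ : ∀ y p q, ChainAngle Γ y 4 p q → s(s(y, p), s(y, q)) ∈ Θ) {d : ℝ}
    (hd : 4 * (δ : ℝ) ≤ d) (x₀ : V) {W W' : Set V}
    (hW : ∀ v ∈ W, ∀ w, Between Γ v w x₀ → w ∈ W) (hWW' : W ⊆ W')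
    (S : Finset V) (hSW : ∀ v ∈ S, v ∈ W) (hS : ∃ u ∈ S, u ≠ x₀) :
    ∃ φ : V → V, (∀ v ∈ S, φ v ∈ W) ∧
      ∑ v ∈ S, Γ.dist (φ v) x₀ < ∑ v ∈ S, Γ.dist v x₀ ∧
      ∀ s ∈ (spanned (relativeRips Γ d Θ) W').faces, s ⊆ S →
        s ∪ s.image φ ∈ (spanned (relativeRips Γ d Θ) W').faces := by
  obtain ⟨v, hv, v', hbt, hlt, hj⟩ := exists_move hconn hδpos hδ hΘ hd x₀ S hS
  have hd0 : 0 ≤ d := le_trans (by positivity) hd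
  have hW' : v' ∈ W := hW v (hSW v hv) v' hbt
  have hφ : ∀ u, u ≠ v → Function.update id v v' u = u := fun u hu => by simp [hu]
  refine ⟨Function.update id v v', fun u hu => ?_, ?_, ?_⟩
  · rcases eq_or_ne u v with rfl | huv
    · simpa using hW'
    · rw [hφ u huv]
      exact hSW u hu
  · refine Finset.sum_lt_sum (fun u _ => ?_) ⟨v, hv, by simpa using hlt⟩
    rcases eq_or_ne u v with rfl | huv
    · simpa using hlt.le
    · rw [hφ u huv]
  · rintro s ⟨⟨hne, hs⟩, hsW⟩ hsS
    have hmem : ∀ u ∈ s ∪ s.image (Function.update id v v'), u ∈ s ∨ (v ∈ s ∧ u = v') := by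
      intro u hu
      rcases Finset.mem_union.1 hu with hu | hu
      · exact Or.inl hu
      · obtain ⟨w, hw, rfl⟩ := Finset.mem_image.1 hu
        rcases eq_or_ne w v with rfl | hwv
        · exact Or.inr ⟨hw, by simp⟩
        · rw [hφ w hwv]
          exact Or.inl hw
    refine ⟨⟨hne.mono Finset.subset_union_left, fun a ha b hb => ?_⟩, fun a ha => ?_⟩
    · rcases hmem a ha with ha' | ⟨hvs, rfl⟩ <;> rcases hmem b hb with hb' | ⟨hvs', rfl⟩
      · exact hs a ha' b hb'
      · exact (hj a (hsS ha') (hs v hvs' a ha')).symm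
      · exact hj b (hsS hb') (hs v hvs b hb')
      · exact smallJoined_self hconn hd0 Θ _
    · rcases hmem a ha with ha | ⟨-, rfl⟩
      · exact hsW a ha
      · exact hWW' hW'

theorem spanned_univ (P : PreAbstractSimplicialComplex V) : spanned P Set.univ = P :=
  PreAbstractSimplicialComplex.ext (by simp [spanned])

theorem le_spanned_geodesicHull (hconn : Γ.Connected) {K P : PreAbstractSimplicialComplex V}
    (hK : K ≤ P) : K ≤ spanned P (geodesicHull Γ K) := by
  intro s hs
  refine ⟨hK hs, fun v hv => ?_⟩
  have hvK : {v} ∈ K.faces := face_of_subset hs (by simpa using hv) (by simp)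
  obtain ⟨c, hc, hvc⟩ := Between.exists_geodesic hconn (show Between Γ v v v by simp [Between])
  exact ⟨v, v, hvK, hvK, c, hc, hvc⟩

theorem relativeRips_contractibleSpace (hconn : Γ.Connected) {δ : ℕ} (hδpos : 0 < δ)
    (hδ : IsHyperbolicityConstant Γ δ) {Θ : Set (Sym2 (Sym2 V))}
    (hΘ : ∀ y p q, ChainAngle Γ y 4 p q → s(s(y, p), s(y, q)) ∈ Θ) {d : ℝ}
    (hd : 4 * (δ : ℝ) ≤ d) : ContractibleSpace (Realization (relativeRips Γ d Θ)) := by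
  obtain ⟨x₀⟩ := hconn.nonempty
  have hd0 : 0 ≤ d := le_trans (by positivity) hd
  refine contractibleSpace_of_finitelyNullhomotopic (singleton_mem_relativeRips hconn hd0 Θ x₀)
    fun X _ S f hf => exists_homotopicWith_const (fun v => Γ.dist v x₀) Set.univ
      (fun S hS hne => ?_) S (fun _ _ => Set.mem_univ _) f hf
  have h := exists_contiguous_move hconn hδpos hδ hΘ hd x₀ (W := Set.univ) (W' := Set.univ)
    (fun _ _ _ _ => Set.mem_univ _) subset_rfl S hS hne
  rwa [spanned_univ] at h

theorem inclusion_nullhomotopic (hconn : Γ.Connected) {δ : ℕ} (hδpos : 0 < δ)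
    (hδ : IsHyperbolicityConstant Γ δ) {Θ : Set (Sym2 (Sym2 V))}
    (hΘ : ∀ y p q, ChainAngle Γ y 4 p q → s(s(y, p), s(y, q)) ∈ Θ) {d : ℝ}
    (hd : 4 * (δ : ℝ) ≤ d) {K : PreAbstractSimplicialComplex V} (hfin : K.faces.Finite)
    (hne : K.faces.Nonempty)
    (h : K ≤ spanned (relativeRips Γ d Θ) (geodesicHull Γ K)) :
    (Realization.inclusion h).Nullhomotopic := by
  classical
  obtain ⟨s₀, hs₀⟩ := hne
  obtain ⟨x₀, hx₀⟩ := face_nonempty hs₀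
  have hvert : ∀ s ∈ K.faces, ∀ v ∈ s, {v} ∈ K.faces := fun s hs v hv =>
    face_of_subset hs (by simpa using hv) (by simp)
  -- The full hull need not contain geodesics from its points to x₀. Using only geodesics ending in
  -- x₀ gives a part of it that does.
  let W : Set V := {w | ∃ v, {v} ∈ K.faces ∧ Between Γ v w x₀}
  have hWhull : W ⊆ geodesicHull Γ K := by
    rintro w ⟨v, hv, hb⟩
    obtain ⟨c, hc, hw⟩ := hb.exists_geodesic hconn
    exact ⟨v, x₀, hv, hvert s₀ hs₀ x₀ hx₀, c, hc, hw⟩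
  have hW : ∀ v ∈ W, ∀ w, Between Γ v w x₀ → w ∈ W := by
    rintro v ⟨u, hu, hb⟩ w hw
    exact ⟨u, hu, hb.trans_left hconn hw⟩
  let S : Finset V := hfin.toFinset.biUnion id
  have hSmem : ∀ s ∈ K.faces, s ⊆ S := fun s hs v hv =>
    Finset.mem_biUnion.2 ⟨s, hfin.mem_toFinset.2 hs, hv⟩
  have hSW : ∀ v ∈ S, v ∈ W := by
    intro v hv
    obtain ⟨s, hs, hvs⟩ := Finset.mem_biUnion.1 hv
    exact ⟨v, hvert s (hfin.mem_toFinset.1 hs) v hvs, by simp [Between]⟩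
  let f : C(Realization K, V → ℝ) := ⟨fun x => x.1, Realization.continuous_val K⟩
  have hf : Supported (spanned (relativeRips Γ d Θ) (geodesicHull Γ K)) S f := by
    intro x
    obtain ⟨s, hs, hx⟩ := x.2
    exact ⟨⟨s, h hs, hx⟩, (closedSimplex_mono (hSmem s hs) hx).2.1⟩
  obtain ⟨T, ⟨F⟩⟩ := exists_homotopicWith_const (fun v => Γ.dist v x₀) W
    (exists_contiguous_move hconn hδpos hδ hΘ hd x₀ hW hWhull) S hSW f hf
  refine ⟨⟨Pi.single x₀ 1, {x₀}, h (hvert s₀ hs₀ x₀ hx₀), single_mem_closedSimplex x₀⟩,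
    ⟨⟨⟨fun p => ⟨F p, (F.prop' p.1 p.2).1⟩, ?_⟩, fun x => ?_, fun x => ?_⟩⟩⟩
  · exact Realization.continuous_of_coordinates (fun p => (F.prop' p.1 p.2).2) F.continuous
  · exact Subtype.ext (F.apply_zero x)
  · exact Subtype.ext (F.apply_one x)

end RelativeRips

end RelRips

theorem propositionA5 {G : Type*} [Group G] [Countable G] {V : Type*} [MulAction G V]
    (Γ : SimpleGraph V) (hconn : Γ.Connected) (hfine : RelRips.IsFine Γ)
    (hact : RelRips.IsCocompactEdgeFiniteAction G Γ)
    (hinf : ∀ u v : V, Γ.Adj u v → (Γ.neighborSet u).Finite ∨ (Γ.neighborSet v).Finite)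
    (δ : ℕ) (hδpos : 0 < δ) (hδ : RelRips.IsHyperbolicityConstant Γ δ)
    (Θ : Set (Sym2 (Sym2 V))) (hΘ : RelRips.IsSizeForAngles G Γ Θ)
    (d : ℝ) (hd : 4 * (δ : ℝ) ≤ d)
    (h7 : RelRips.angleMultiple Γ (RelRips.thetaThree Γ) 7 ⊆ Θ) :
    ContractibleSpace (RelRips.Realization (RelRips.relativeRips Γ d Θ)) ∧
    ∀ K : PreAbstractSimplicialComplex V, K ≤ RelRips.relativeRips Γ d Θ →
      K.faces.Finite → K.faces.Nonempty →
      ∃ h : K ≤ RelRips.spanned (RelRips.relativeRips Γ d Θ) (RelRips.geodesicHull Γ K),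
        (RelRips.Realization.inclusion h).Nullhomotopic := by
  have hchain : ∀ y p q, RelRips.ChainAngle Γ y 4 p q → s(s(y, p), s(y, q)) ∈ Θ :=
    fun y p q h => h7 (h.mono hconn (by norm_num)).mem_angleMultiple
  exact ⟨RelRips.relativeRips_contractibleSpace hconn hδpos hδ hchain hd, fun K hK hfin hne =>
    ⟨RelRips.le_spanned_geodesicHull hconn hK,
      RelRips.inclusion_nullhomotopic hconn hδpos hδ hchain hd hfin hne _⟩⟩
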